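/- Let $p>0$ and $a_k=k^{p-1}$ for $k\ge 1$. For $N\ge 1$ let $\Omega_N$ be the set of partitions of $N$, i.e. of vectors $\eta=(n_1,\dots,n_N)$ of nonnegative integers with $\sum_{j=1}^N j\,n_j=N$ (there are $n_j$ groups of size $j$), and let $\mu_N$ be the probability measure on $\Omega_N$ given by $$\mu_N(\eta)=\frac1{c_N}\prod_{j=1}^N\frac{a_j^{n_j}}{n_j!},\qquad c_N=\sum_{\eta\in\Omega_N}\prod_{j=1}^N\frac{a_j^{n_j}}{n_j!},$$ which is the equilibrium (invariant) measure of the reversible coagulation-fragmentation processes with parameter function $a$. Let $\nu_N(\eta)=n_1+\dots+n_N$ be the number of groups of a random partition $\eta$ with distribution $\mu_N$. Set $$Q_p=p^{-1}\,\Gamma(p+1)^{1/(p+1)},\qquad d_p=\frac{Q_p}{p+1}.$$ Then, as $N\to\infty$, $$\frac{\nu_N-Q_p\,N^{p/(p+1)}}{\sqrt{d_p}\;N^{p/(2p+2)}}\Rightarrow \mathcal N(0,1),$$ where $\Rightarrow$ denotes weak convergence (convergence in distribution) and $\mathcal N(0,1)$ is the standard normal law. -/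

import Mathlib

open MeasureTheory ProbabilityTheory Filter

noncomputable section

namespace CoagFrag

/-- Partitions of `N` form a finite set, and every subset is an event. -/
instance instMeasurableSpacePartition (N : ℕ) : MeasurableSpace (Nat.Partition N) := ⊤

instance instMeasurableSingletonClassPartition (N : ℕ) :
    MeasurableSingletonClass (Nat.Partition N) := ⟨fun _ => trivial⟩

/-- The number `n_j` of groups of size `j` in the partition `η`. -/
def groupCount {N : ℕ} (η : Nat.Partition N) (j : ℕ) : ℕ := η.parts.count j

/-- The number `ν_N(η) = n_1 + ⋯ + n_N` of groups of the partition `η` of `N`. -/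
def numGroups {N : ℕ} (η : Nat.Partition N) : ℕ := ∑ j ∈ Finset.Icc 1 N, groupCount η j

/-- The weight `∏_{j=1}^N a_j ^ {n_j} / n_j!` of a partition `η = (n_1, …, n_N)` of `N`. -/
def weight (a : ℕ → ℝ) {N : ℕ} (η : Nat.Partition N) : ℝ :=
  ∏ j ∈ Finset.Icc 1 N, a j ^ groupCount η j / (Nat.factorial (groupCount η j) : ℝ)

/-- The partition function `c_N = ∑_η ∏_{j=1}^N a_j ^ {n_j} / n_j!`. -/
def partitionFunction (a : ℕ → ℝ) (N : ℕ) : ℝ := ∑ η : Nat.Partition N, weight a η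

/-- The equilibrium measure `μ_N` on the partitions of `N` with parameter function `a`:
`μ_N(η) = c_N⁻¹ ∏_{j=1}^N a_j ^ {n_j} / n_j!`. -/
def equilibriumMeasure (a : ℕ → ℝ) (N : ℕ) : Measure (Nat.Partition N) :=
  ∑ η : Nat.Partition N, ENNReal.ofReal (weight a η / partitionFunction a N) • Measure.dirac η

/-- The parameter function `a_k = k ^ (p - 1)`, of which only the values at `k ≥ 1` are used. -/
def powerParam (p : ℝ) (k : ℕ) : ℝ := (k : ℝ) ^ (p - 1)

/-- `Q_p = p⁻¹ Γ(p + 1) ^ (1 / (p + 1))`. -/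
def Q (p : ℝ) : ℝ := p⁻¹ * Real.Gamma (p + 1) ^ (1 / (p + 1))

/-- `d_p = Q_p / (p + 1)`. -/
def d (p : ℝ) : ℝ := Q p / (p + 1)

theorem weight_pos {a : ℕ → ℝ} (ha : ∀ k, 1 ≤ k → 0 < a k) {N : ℕ} (η : Nat.Partition N) :
    0 < weight a η :=
  Finset.prod_pos fun j hj => div_pos (pow_pos (ha j (Finset.mem_Icc.1 hj).1) _)
    (Nat.cast_pos.2 (Nat.factorial_pos _))

theorem partitionFunction_pos {a : ℕ → ℝ} (ha : ∀ k, 1 ≤ k → 0 < a k) (N : ℕ) :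
    0 < partitionFunction a N :=
  Finset.sum_pos (fun η _ => weight_pos ha η) Finset.univ_nonempty

theorem isProbabilityMeasure_equilibriumMeasure {a : ℕ → ℝ} (ha : ∀ k, 1 ≤ k → 0 < a k)
    (N : ℕ) : IsProbabilityMeasure (equilibriumMeasure a N) := by
  constructor
  have hc := partitionFunction_pos ha N
  simp only [equilibriumMeasure, Measure.coe_finsetSum, Finset.sum_apply, Measure.smul_apply,
    measure_univ, smul_eq_mul, mul_one]
  rw [← ENNReal.ofReal_sum_of_nonneg fun η _ => (div_pos (weight_pos ha η) hc).le,
    ← Finset.sum_div, ← partitionFunction, div_self hc.ne', ENNReal.ofReal_one]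

theorem powerParam_pos (p : ℝ) (k : ℕ) (hk : 1 ≤ k) : 0 < powerParam p k :=
  Real.rpow_pos_of_pos (by exact_mod_cast hk) _

instance instIsProbabilityMeasurePowerParam (p : ℝ) (N : ℕ) :
    IsProbabilityMeasure (equilibriumMeasure (powerParam p) N) :=
  isProbabilityMeasure_equilibriumMeasure (powerParam_pos p) N

end CoagFrag

end

/-!
The proof is a saddle point argument with exact centring. Put `λ_k = k ^ (p - 1) exp (- δ k)`,
where `δ = saddle p N` solves `Γ(p + 1) δ ^ (-(p + 1)) = N`. For independent Poisson variables
`Z_k` with means `λ_k`, `k ≤ N`, the measure `μ_N` is the law of `(Z_k)` given `∑ k Z_k = N`.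
Accordingly Cauchy's formula (`integral_exp_sum_eq_sum_partition`) writes the characteristic
function of the centred and normalised `ν_N` as a quotient of integrals over `θ ∈ [-π, π]` of the
joint characteristic function `exp (logCharFun p N s θ)` of `(∑ Z_k, ∑ k Z_k)`, centred at
`(Γ(p) δ ^ (-p), N)`; see `charFun_map_eq`. Here `Γ(p) δ ^ (-p)` is exactly `Q_p N ^ (p / (p + 1))`.

Three facts then give the limit.

* `exists_tsum_sub_Gamma_le`: `∑ k ^ (q - 1) exp (- δ k) = Γ(q) δ ^ (-q) + O(1)` for every `q > 0`.
  The centring in the theorem requires an error `o(δ ^ (-p / 2))` for `q = p`, whereas comparing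
  the sum with an integral only gives `O(δ ^ (1 - q))`, which is insufficient for `p ≥ 2`. For
  `q > 1` the estimate comes from Poisson's summation formula, the Fourier transform of
  `x ^ (q - 1) exp (- δ x)` being `Γ(q) (δ + 2πiξ) ^ (-q)`; for `q ≤ 1` the summand is decreasing
  and the elementary comparison is enough.
* `tendsto_logCharFun`: with `s = a δ ^ (p / 2)` and `θ = b δ ^ (p / 2 + 1)` the exponent tends to
  `- (a² Γ(p) + 2 a b Γ(p + 1) + b² Γ(p + 2)) / 2`, by a second order Taylor expansion.
* `exists_le_sum_one_sub_cos`: `∑ λ_k (1 - cos (s + k θ))` is at least a constant times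
  `δ ^ (-p) min (1, (θ / δ)²)`, uniformly in `s`, which provides an integrable majorant.

Dominated convergence and a Gaussian integral in `b` leave the variance
`a² (Γ(p) - Γ(p + 1)² / Γ(p + 2)) = a² Γ(p) / (p + 1)`, which is the one normalised by `d_p`, and
Lévy's continuity theorem concludes.
-/

open Topology

/-! ### Cauchy's formula for weighted partitions -/

/-- The value at `z` of the power series `P`; only used where the coefficients are absolutely
summable and `‖z‖ = 1`. -/
noncomputable def circleEval (P : PowerSeries ℂ) (z : ℂ) : ℂ := ∑' n, P.coeff n * z ^ n

theorem summable_coeff_mul_pow {P : PowerSeries ℂ} (hP : Summable fun n => ‖P.coeff n‖)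
    {z : ℂ} (hz : ‖z‖ = 1) : Summable fun n => ‖P.coeff n * z ^ n‖ := by
  simpa [hz] using hP

theorem summable_norm_sum_antidiagonal {f g : ℕ → ℂ} (hf : Summable fun n => ‖f n‖)
    (hg : Summable fun n => ‖g n‖) :
    Summable fun n => ‖∑ kl ∈ Finset.HasAntidiagonal.antidiagonal n, f kl.1 * g kl.2‖ :=
  summable_norm_sum_mul_antidiagonal_of_summable_norm hf hg

theorem summable_norm_coeff_mul {P R : PowerSeries ℂ} (hP : Summable fun n => ‖P.coeff n‖)
    (hR : Summable fun n => ‖R.coeff n‖) : Summable fun n => ‖(P * R).coeff n‖ := by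
  have h := summable_norm_sum_antidiagonal hP hR
  refine h.congr fun n => ?_
  rw [PowerSeries.coeff_mul]

theorem circleEval_mul {P R : PowerSeries ℂ} (hP : Summable fun n => ‖P.coeff n‖)
    (hR : Summable fun n => ‖R.coeff n‖) {z : ℂ} (hz : ‖z‖ = 1) :
    circleEval (P * R) z = circleEval P z * circleEval R z := by
  unfold circleEval
  rw [tsum_mul_tsum_eq_tsum_sum_antidiagonal_of_summable_norm (summable_coeff_mul_pow hP hz)
    (summable_coeff_mul_pow hR hz)]
  refine tsum_congr fun n => ?_
  rw [PowerSeries.coeff_mul, Finset.sum_mul]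
  refine Finset.sum_congr rfl fun kl hkl => ?_
  rw [← Finset.HasAntidiagonal.mem_antidiagonal.1 hkl, pow_add]
  ring

/-- Absolute summability is part of the statement because the induction needs it for the partial
products. -/
theorem circleEval_prod {ι : Type*} (s : Finset ι) (P : ι → PowerSeries ℂ)
    (hP : ∀ i ∈ s, Summable fun n => ‖(P i).coeff n‖) :
    (Summable fun n => ‖(∏ i ∈ s, P i).coeff n‖) ∧
      ∀ z : ℂ, ‖z‖ = 1 → circleEval (∏ i ∈ s, P i) z = ∏ i ∈ s, circleEval (P i) z := by
  classical
  induction s using Finset.induction_on with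
  | empty =>
    simp only [Finset.prod_empty, circleEval, PowerSeries.coeff_one]
    refine ⟨(hasSum_ite_eq 0 (1 : ℝ)).summable.congr fun n => by split_ifs <;> simp, fun z _ => ?_⟩
    rw [tsum_eq_single 0 (by intro n hn; simp [hn])]
    simp
  | insert i s hi ih =>
    obtain ⟨h1, h2⟩ := ih fun j hj => hP j (Finset.mem_insert_of_mem hj)
    have h3 := hP i (Finset.mem_insert_self i s)
    simp only [Finset.prod_insert hi]
    exact ⟨summable_norm_coeff_mul h3 h1, fun z hz => by rw [circleEval_mul h3 h1 hz, h2 z hz]⟩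

/-- The power series `exp (h X ^ j)`. -/
noncomputable def expMonomial (h : ℂ) (j : ℕ) : PowerSeries ℂ :=
  PowerSeries.mk fun n => if j ∣ n then h ^ (n / j) / (n / j).factorial else 0

/-- A family supported on the multiples of `j` may be summed over these. -/
theorem hasSum_of_hasSum_mul_left {E : Type*} [AddCommMonoid E] [TopologicalSpace E] {j : ℕ}
    (hj : j ≠ 0) (g : ℕ → E) (hg : ∀ n, ¬ j ∣ n → g n = 0) {a : E}
    (h : HasSum (fun m => g (j * m)) a) :
    HasSum g a := by
  refine (Function.Injective.hasSum_iff (mul_right_injective₀ hj) fun n hn => hg n ?_).1 h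
  rintro ⟨m, rfl⟩
  exact hn ⟨m, rfl⟩

theorem summable_norm_coeff_expMonomial (h : ℂ) {j : ℕ} (hj : j ≠ 0) :
    Summable fun n => ‖(expMonomial h j).coeff n‖ := by
  refine (hasSum_of_hasSum_mul_left hj _ (fun n hn => by simp [expMonomial, hn])
    (Summable.hasSum ?_)).summable
  have := NormedSpace.norm_expSeries_div_summable (𝔸 := ℂ) h
  simpa [expMonomial, Nat.mul_div_cancel_left _ (Nat.pos_of_ne_zero hj)] using this

theorem circleEval_expMonomial (h : ℂ) {j : ℕ} (hj : j ≠ 0) (z : ℂ) :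
    circleEval (expMonomial h j) z = Complex.exp (h * z ^ j) := by
  refine (hasSum_of_hasSum_mul_left hj _ (fun n hn => by simp [expMonomial, hn]) ?_).tsum_eq
  have := NormedSpace.expSeries_div_hasSum_exp (h * z ^ j)
  rw [← Complex.exp_eq_exp_ℂ] at this
  refine this.congr_fun fun n => ?_
  simp [expMonomial, Nat.mul_div_cancel_left _ (Nat.pos_of_ne_zero hj), mul_pow, pow_mul]
  ring

open PowerSeries PowerSeries.WithPiTopology in
/-- The factors of `Nat.Partition.genFun` for the weights `h ^ c / c!` are exponentials. -/
theorem one_add_tsum_eq_expMonomial (h : ℂ) {j : ℕ} (hj : j ≠ 0) :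
    1 + ∑' c : ℕ, (h ^ (c + 1) / ((c + 1).factorial : ℂ)) • (X : PowerSeries ℂ) ^ (j * (c + 1)) =
      expMonomial h j := by
  ext n
  have hs := Nat.Partition.summable_genFun_term' (R := ℂ)
    (fun _ c => h ^ c / (c.factorial : ℂ)) hj
  rw [map_add, hs.map_tsum _ (WithPiTopology.continuous_coeff _ _)]
  simp only [coeff_one, map_smul, coeff_X_pow, expMonomial, coeff_mk, smul_eq_mul, mul_ite,
    mul_one, mul_zero]
  by_cases hn : j ∣ n
  · obtain ⟨m, rfl⟩ := hn
    rw [if_pos (dvd_mul_right _ _), Nat.mul_div_cancel_left _ (Nat.pos_of_ne_zero hj)]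
    rcases m with _ | m
    · simp [hj]
    · rw [tsum_eq_single m]
      · simp [hj]
      · intro b hb
        rw [if_neg]
        intro h
        have := mul_left_cancel₀ hj h
        omega
  · rw [if_neg hn, if_neg (by rintro rfl; simp at hn)]
    have : ∀ c, n ≠ j * (c + 1) := fun c hc => hn ⟨_, hc⟩
    simp [this]

open PowerSeries PowerSeries.WithPiTopology in
/-- The exponential formula for partitions, in the degrees that only involve parts at most `N`. -/
theorem coeff_prod_expMonomial (h : ℕ → ℂ) (N : ℕ) :
    (∏ j ∈ Finset.Icc 1 N, expMonomial (h j) j).coeff N =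
      ∑ η : Nat.Partition N, ∏ j ∈ Finset.Icc 1 N,
        h j ^ CoagFrag.groupCount η j / ((CoagFrag.groupCount η j).factorial : ℂ) := by
  -- Parts larger than `N` get weight zero, so that the infinite product becomes finite.
  let f : ℕ → ℕ → ℂ := fun j c => if j ≤ N then h j ^ c / (c.factorial : ℂ) else 0
  have h1 : Nat.Partition.genFun f = ∏ j ∈ Finset.Icc 1 N, expMonomial (h j) j := by
    rw [Nat.Partition.genFun_eq_tprod, tprod_eq_prod (s := Finset.range N)]
    · have hI : Finset.Icc 1 N = Finset.Ico (0 + 1) (N + 1) := by ext; simp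
      rw [hI, ← Finset.prod_Ico_add', ← Finset.range_eq_Ico]
      refine Finset.prod_congr rfl fun i hi => ?_
      rw [← one_add_tsum_eq_expMonomial _ (Nat.succ_ne_zero i)]
      have : i + 1 ≤ N := by simpa using hi
      simp [f, this]
    · intro i hi
      have : ¬ i + 1 ≤ N := by simpa using hi
      simp [f, this]
  rw [← h1, Nat.Partition.coeff_genFun]
  refine Finset.sum_congr rfl fun η _ => ?_
  rw [Finsupp.prod_of_support_subset (s := Finset.Icc 1 N)]
  · refine Finset.prod_congr rfl fun j hj => ?_
    simp [f, (Finset.mem_Icc.1 hj).2, CoagFrag.groupCount]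
  · intro j hj
    simp only [Multiset.toFinsupp_support, Multiset.mem_toFinset] at hj
    exact Finset.mem_Icc.2 ⟨η.parts_pos hj, η.le_of_mem_parts hj⟩
  · intro j hj
    simp [f, (Finset.mem_Icc.1 hj).2]

theorem integral_exp_int_mul_I (n : ℤ) :
    ∫ θ in (-Real.pi)..Real.pi, Complex.exp (n * θ * Complex.I) =
      if n = 0 then 2 * Real.pi else 0 := by
  split_ifs with hn
  · subst hn
    simp; ring
  · have hc : (n * Complex.I : ℂ) ≠ 0 := by simp [hn]
    have := integral_exp_mul_complex (a := -Real.pi) (b := Real.pi) hc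
    rw [show (fun θ : ℝ => Complex.exp (n * θ * Complex.I)) =
      fun θ : ℝ => Complex.exp (n * Complex.I * θ) by ext; ring_nf, this]
    have h2 : Complex.exp (n * Complex.I * (Real.pi : ℝ)) =
        Complex.exp (n * Complex.I * ((-Real.pi : ℝ))) := by
      rw [Complex.exp_eq_exp_iff_exists_int]
      exact ⟨n, by push_cast; ring⟩
    rw [h2]
    simp

/-- Fourier inversion for an absolutely convergent power series on the unit circle. -/
theorem integral_circleEval {P : PowerSeries ℂ} (hP : Summable fun n => ‖P.coeff n‖) (N : ℕ) :
    ∫ θ in (-Real.pi)..Real.pi, circleEval P (Complex.exp (θ * Complex.I)) *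
      Complex.exp (-(N * θ * Complex.I)) = 2 * Real.pi * P.coeff N := by
  have key : HasSum (fun n : ℕ => ∫ θ in (-Real.pi)..Real.pi,
      P.coeff n * Complex.exp ((n - N : ℤ) * θ * Complex.I))
      (∫ θ in (-Real.pi)..Real.pi, circleEval P (Complex.exp (θ * Complex.I)) *
        Complex.exp (-(N * θ * Complex.I))) := by
    refine intervalIntegral.hasSum_integral_of_dominated_convergence
      (fun n _ => ‖P.coeff n‖) (fun n => ?_) (fun n => ?_) ?_ ?_ ?_
    · exact Continuous.aestronglyMeasurable (by fun_prop)
    · refine Eventually.of_forall fun θ _ => ?_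
      rw [norm_mul, show ((n - N : ℤ) * θ * Complex.I : ℂ) =
        (((n - N : ℤ) * θ : ℝ) : ℂ) * Complex.I by push_cast; ring,
        Complex.norm_exp_ofReal_mul_I, mul_one]
    · exact Eventually.of_forall fun θ _ => hP
    · exact intervalIntegrable_const
    · refine Eventually.of_forall fun θ _ => ?_
      have := (summable_coeff_mul_pow hP
        (Complex.norm_exp_ofReal_mul_I θ)).of_norm.hasSum.mul_right
        (Complex.exp (-(N * θ * Complex.I)))
      refine this.congr_fun fun n => ?_
      rw [← Complex.exp_nat_mul, mul_assoc (P.coeff n), ← Complex.exp_add]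
      congr 2
      push_cast
      ring
  rw [← key.tsum_eq, tsum_eq_single N]
  · rw [intervalIntegral.integral_const_mul, integral_exp_int_mul_I]
    simp; ring
  · intro n hn
    rw [intervalIntegral.integral_const_mul, integral_exp_int_mul_I, if_neg (by omega),
      Complex.ofReal_zero, mul_zero]

/-- Cauchy's formula: the `N`-th Fourier coefficient of `exp (∑ h k z ^ k)` is the weighted sum over
the partitions of `N`. -/
theorem integral_exp_sum_eq_sum_partition (h : ℕ → ℂ) (N : ℕ) :
    ∫ θ in (-Real.pi)..Real.pi,
      Complex.exp (∑ k ∈ Finset.Icc 1 N, h k * Complex.exp (k * θ * Complex.I)) *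
        Complex.exp (-(N * θ * Complex.I)) =
      2 * Real.pi * ∑ η : Nat.Partition N, ∏ j ∈ Finset.Icc 1 N,
        h j ^ CoagFrag.groupCount η j / ((CoagFrag.groupCount η j).factorial : ℂ) := by
  have hpos : ∀ j ∈ Finset.Icc 1 N, j ≠ 0 := fun j hj => by
    have := (Finset.mem_Icc.1 hj).1
    omega
  obtain ⟨h1, h2⟩ := circleEval_prod (Finset.Icc 1 N) (fun j => expMonomial (h j) j)
    fun j hj => summable_norm_coeff_expMonomial _ (hpos j hj)
  rw [← coeff_prod_expMonomial, ← integral_circleEval h1]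
  refine intervalIntegral.integral_congr fun θ _ => ?_
  rw [h2 _ (Complex.norm_exp_ofReal_mul_I θ), Complex.exp_sum]
  congr 1
  refine Finset.prod_congr rfl fun j hj => ?_
  rw [circleEval_expMonomial _ (hpos j hj), ← Complex.exp_nat_mul]
  ring_nf

/-! ### Poisson summation for `∑ k ^ (q - 1) exp (- δ k)` -/

theorem integrableOn_rpow_mul_exp_neg {q δ : ℝ} (hq : 0 < q) (hδ : 0 < δ) :
    IntegrableOn (fun x : ℝ => x ^ (q - 1) * Real.exp (-(δ * x))) (Set.Ioi 0) :=
  .of_integral_ne_zero (by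
    rw [Real.integral_rpow_mul_exp_neg_mul_Ioi hq hδ]
    have := Real.Gamma_pos_of_pos hq
    positivity)

/-- The measure with density `x ^ (q - 1)` on the positive half-line. -/
noncomputable def rpowMeasure (q : ℝ) : Measure ℝ :=
  (volume.restrict (Set.Ioi 0)).withDensity fun x => ENNReal.ofReal (x ^ (q - 1))

/-- Turns the Gamma integral with complex rate `r` into the moment generating function of
`rpowMeasure q` at `-r`, whose analyticity is available. -/
theorem integral_rpowMeasure (q : ℝ) (g : ℝ → ℂ) :
    ∫ x, g x ∂(rpowMeasure q) = ∫ x in Set.Ioi 0, ((x ^ (q - 1) : ℝ) : ℂ) * g x := by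
  rw [rpowMeasure, integral_withDensity_eq_integral_toReal_smul (by fun_prop)
    (Eventually.of_forall fun _ => ENNReal.ofReal_lt_top)]
  refine setIntegral_congr_fun measurableSet_Ioi fun x hx => ?_
  simp only [ENNReal.toReal_ofReal (Real.rpow_nonneg (le_of_lt hx) _), Complex.real_smul]

theorem mem_integrableExpSet_rpowMeasure {q t : ℝ} (hq : 0 < q) (ht : t < 0) :
    t ∈ integrableExpSet id (rpowMeasure q) := by
  rw [integrableExpSet, Set.mem_ofPred_eq, rpowMeasure,
    integrable_withDensity_iff_integrable_smul' (by fun_prop)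
    (Eventually.of_forall fun _ => ENNReal.ofReal_lt_top)]
  refine (integrableOn_rpow_mul_exp_neg hq (neg_pos.2 ht)).congr_fun (fun x hx => ?_)
    measurableSet_Ioi
  simp [ENNReal.toReal_ofReal (Real.rpow_nonneg (le_of_lt hx) _)]

theorem interior_integrableExpSet_rpowMeasure {q : ℝ} (hq : 0 < q) :
    Set.Iio 0 ⊆ interior (integrableExpSet id (rpowMeasure q)) :=
  interior_maximal (fun _ ht => mem_integrableExpSet_rpowMeasure hq ht) isOpen_Iio

/-- The Gamma integral with a complex rate, by analytic continuation from real rates. -/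
theorem integral_rpow_mul_cexp_neg_mul {q : ℝ} (hq : 0 < q) {r : ℂ} (hr : 0 < r.re) :
    ∫ x in Set.Ioi (0 : ℝ), ((x ^ (q - 1) : ℝ) : ℂ) * Complex.exp (-(r * x)) =
      (1 / r) ^ (q : ℂ) * Real.Gamma q := by
  have hU : IsOpen {z : ℂ | z.re < 0} := isOpen_lt Complex.continuous_re continuous_const
  have h1 : AnalyticOnNhd ℂ (complexMGF id (rpowMeasure q)) {z | z.re < 0} :=
    analyticOnNhd_complexMGF.mono fun z hz => interior_integrableExpSet_rpowMeasure hq hz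
  have h2 : AnalyticOnNhd ℂ (fun z : ℂ => (1 / (-z)) ^ (q : ℂ) * Real.Gamma q)
      {z | z.re < 0} := by
    refine DifferentiableOn.analyticOnNhd (fun z hz => ?_) hU
    have hz' : z.re < 0 := hz
    have hz0 : -z ≠ 0 := by
      intro h
      have := congrArg Complex.re h
      simp at this
      linarith
    refine DifferentiableAt.differentiableWithinAt ?_
    refine DifferentiableAt.mul_const (DifferentiableAt.cpow_const ?_ ?_) _
    · exact (differentiableAt_const _).div differentiableAt_id.neg hz0
    · left
      rw [one_div, Complex.inv_re]
      refine div_pos (by simpa using hz') (Complex.normSq_pos.2 hz0)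
  have key := h1.eqOn_of_preconnected_of_frequently_eq h2
    (convex_halfSpace_re_lt 0).isPreconnected (z₀ := -1) (by simp) ?_
  · have := key (show (-r) ∈ {z : ℂ | z.re < 0} by simpa using hr)
    rw [complexMGF, integral_rpowMeasure] at this
    simpa using this
  · have hreal : ∀ x : ℝ, 0 < x → complexMGF id (rpowMeasure q) (-(x : ℂ)) =
        (1 / (-(-(x : ℂ)))) ^ (q : ℂ) * Real.Gamma q := by
      intro x hx
      have := Complex.integral_cpow_mul_exp_neg_mul_Ioi (a := (q : ℂ)) (by simpa using hq) hx
      rw [complexMGF, integral_rpowMeasure, neg_neg, Complex.Gamma_ofReal] at *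
      rw [← this]
      refine setIntegral_congr_fun measurableSet_Ioi fun y hy => ?_
      rw [Complex.ofReal_cpow (le_of_lt hy)]
      push_cast
      simp
    -- The two sides agree on the negative reals, which accumulate at `-1`.
    have ht : Tendsto (fun n : ℕ => -(((1 + 1 / ((n : ℝ) + 1) : ℝ)) : ℂ)) atTop (𝓝[≠] (-1)) := by
      rw [tendsto_nhdsWithin_iff]
      constructor
      · have : Tendsto (fun n : ℕ => (1 + 1 / ((n : ℝ) + 1) : ℝ)) atTop (𝓝 (1 + 0)) :=
          tendsto_const_nhds.add tendsto_one_div_add_atTop_nhds_zero_nat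
        have h3 := ((Complex.continuous_ofReal.tendsto _).comp this).neg
        simpa using h3
      · refine Eventually.of_forall fun n => ?_
        have : (0 : ℝ) < 1 / ((n : ℝ) + 1) := by positivity
        simp only [Set.mem_compl_iff, Set.mem_singleton_iff, neg_inj]
        intro h
        have h' : (1 + 1 / ((n : ℝ) + 1) : ℝ) = 1 := by exact_mod_cast h
        linarith
    exact ht.frequently (Frequently.of_forall fun n => hreal _ (by positivity))

/-- The function `x ^ (q - 1) * exp (- δ x)` on the positive half-line, extended by zero. -/
noncomputable def gammaKernel (q δ x : ℝ) : ℝ := (max x 0) ^ (q - 1) * Real.exp (-(δ * x))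

theorem gammaKernel_of_pos {q δ x : ℝ} (hx : 0 < x) :
    gammaKernel q δ x = x ^ (q - 1) * Real.exp (-(δ * x)) := by
  rw [gammaKernel, max_eq_left hx.le]

theorem gammaKernel_of_nonpos {q δ x : ℝ} (hq : 1 < q) (hx : x ≤ 0) : gammaKernel q δ x = 0 := by
  rw [gammaKernel, max_eq_right hx, Real.zero_rpow (by linarith), zero_mul]

theorem continuous_gammaKernel {q δ : ℝ} (hq : 1 < q) : Continuous (gammaKernel q δ) := by
  unfold gammaKernel
  refine Continuous.mul ?_ (by fun_prop)
  exact (continuous_id.max continuous_const).rpow_const fun x => Or.inr (by linarith)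

open Asymptotics in
theorem isBigO_rpow_mul_exp_neg (q : ℝ) {δ : ℝ} (hδ : 0 < δ) (b : ℝ) :
    (fun x : ℝ => x ^ (q - 1) * Real.exp (-(δ * x))) =O[atTop] fun x : ℝ => x ^ (-b) := by
  have h := (isBigO_refl (fun x : ℝ => x ^ (q - 1)) atTop).mul
    (isLittleO_exp_neg_mul_rpow_atTop hδ (1 - q - b)).isBigO
  refine (h.congr' ?_ ?_)
  · exact Eventually.of_forall fun x => by simp
  · filter_upwards [eventually_gt_atTop 0] with x hx
    rw [← Real.rpow_add hx]
    congr 1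
    ring

open Asymptotics in
theorem isBigO_gammaKernel {q δ : ℝ} (hq : 1 < q) (hδ : 0 < δ) :
    (fun x : ℝ => (gammaKernel q δ x : ℂ)) =O[cocompact ℝ] fun x : ℝ => |x| ^ (-q) := by
  rw [cocompact_eq_atBot_atTop, isBigO_sup]
  constructor
  · refine (isBigO_zero (fun x : ℝ => |x| ^ (-q)) atBot).congr' ?_ EventuallyEq.rfl
    filter_upwards [eventually_le_atBot 0] with x hx
    simp [gammaKernel_of_nonpos hq hx]
  · refine IsBigO.of_norm_left ?_
    refine ((isBigO_rpow_mul_exp_neg q hδ q).norm_left).congr' ?_ ?_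
    · filter_upwards [eventually_gt_atTop 0] with x hx
      rw [gammaKernel_of_pos hx, Complex.norm_real]
    · filter_upwards [eventually_gt_atTop 0] with x hx
      rw [abs_of_pos hx]

open FourierTransform in
theorem fourier_gammaKernel {q δ : ℝ} (hq : 1 < q) (hδ : 0 < δ) (ξ : ℝ) :
    𝓕 (fun x : ℝ => (gammaKernel q δ x : ℂ)) ξ =
      (1 / (δ + 2 * Real.pi * ξ * Complex.I)) ^ (q : ℂ) * Real.Gamma q := by
  rw [← integral_rpow_mul_cexp_neg_mul (by linarith) (by simpa using hδ),
    Real.fourier_real_eq_integral_exp_smul, ← integral_indicator measurableSet_Ioi]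
  refine integral_congr_ae (Eventually.of_forall fun x => ?_)
  simp only [Set.indicator_apply, Set.mem_Ioi]
  split_ifs with hx
  · rw [gammaKernel_of_pos hx, smul_eq_mul, Complex.ofReal_mul (x ^ (q - 1)), mul_left_comm,
      Complex.ofReal_exp,
      ← Complex.exp_add]
    congr 2
    push_cast
    ring
  · rw [gammaKernel_of_nonpos hq (not_lt.1 hx)]
    simp

theorem norm_one_div_cpow_le {q : ℝ} (hq : 0 < q) (δ : ℝ) {ξ : ℝ} (hξ : ξ ≠ 0) :
    ‖(1 / (δ + 2 * Real.pi * ξ * Complex.I)) ^ (q : ℂ)‖ ≤ |ξ| ^ (-q) := by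
  have h1 : |ξ| ≤ ‖(δ + 2 * Real.pi * ξ * Complex.I : ℂ)‖ := by
    refine le_trans ?_ (Complex.abs_im_le_norm _)
    have : (δ + 2 * Real.pi * ξ * Complex.I : ℂ).im = 2 * Real.pi * ξ := by simp
    rw [this, abs_mul, abs_of_pos (show (0 : ℝ) < 2 * Real.pi by positivity)]
    nlinarith [abs_nonneg ξ, Real.pi_gt_three]
  have h0 : 0 < |ξ| := abs_pos.2 hξ
  rw [Complex.norm_cpow_real, norm_div, norm_one, Real.rpow_neg h0.le, one_div,
    Real.inv_rpow (norm_nonneg _)]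
  gcongr

open Asymptotics in
theorem summable_rpow_mul_exp_neg (q : ℝ) {δ : ℝ} (hδ : 0 < δ) :
    Summable fun k : ℕ => ((k + 1 : ℕ) : ℝ) ^ (q - 1) * Real.exp (-(δ * (k + 1 : ℕ))) := by
  refine (summable_nat_add_iff
    (f := fun k : ℕ => (k : ℝ) ^ (q - 1) * Real.exp (-(δ * k))) 1).2 ?_
  exact summable_of_isBigO_nat (Real.summable_nat_rpow.2 (by norm_num : (-2 : ℝ) < -1))
    ((isBigO_rpow_mul_exp_neg q hδ 2).comp_tendsto tendsto_natCast_atTop_atTop)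

/-- `∑ k ^ (q - 1) exp (- δ k) = Γ(q) δ ^ (- q) + O(1)` for `q > 1`: in Poisson's formula the zero
frequency gives the main term, and the others are bounded uniformly in `δ`. -/
theorem exists_tsum_sub_Gamma_le_of_one_lt {q : ℝ} (hq : 1 < q) :
    ∃ C : ℝ, ∀ δ : ℝ, 0 < δ →
      |∑' k : ℕ, ((k + 1 : ℕ) : ℝ) ^ (q - 1) * Real.exp (-(δ * (k + 1 : ℕ))) -
        Real.Gamma q * δ ^ (-q)| ≤ C := by
  have hq0 : 0 < q := by linarith
  have hΓ := Real.Gamma_pos_of_pos hq0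
  have hsum := Real.summable_abs_int_rpow hq
  refine ⟨∑' n : ℤ, |(n : ℝ)| ^ (-q) * Real.Gamma q, fun δ hδ => ?_⟩
  have hF : ∀ n : ℤ, n ≠ 0 → ‖(1 / (δ + 2 * Real.pi * (n : ℝ) * Complex.I)) ^ (q : ℂ) *
      Real.Gamma q‖ ≤ |(n : ℝ)| ^ (-q) * Real.Gamma q := by
    intro n hn
    rw [norm_mul, Complex.norm_real, Real.norm_of_nonneg hΓ.le]
    gcongr
    exact norm_one_div_cpow_le hq0 δ (by exact_mod_cast hn)
  have hFs : Summable fun n : ℤ => (1 / (δ + 2 * Real.pi * (n : ℝ) * Complex.I)) ^ (q : ℂ) *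
      Real.Gamma q := by
    refine Summable.of_norm_bounded_eventually (hsum.mul_right (Real.Gamma q)) ?_
    filter_upwards [(Set.finite_singleton (0 : ℤ)).compl_mem_cofinite] with n hn
    exact hF n hn
  have hP := Real.tsum_eq_tsum_fourier_of_rpow_decay_of_summable
    (f := fun x : ℝ => (gammaKernel q δ x : ℂ))
    (Complex.continuous_ofReal.comp (continuous_gammaKernel hq)) hq (isBigO_gammaKernel hq hδ)
    (by simpa only [fourier_gammaKernel hq hδ] using hFs) 0
  simp only [fourier_gammaKernel hq hδ, zero_add, QuotientAddGroup.mk_zero, fourier_eval_zero,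
    mul_one] at hP
  have hL : ∑' n : ℤ, (gammaKernel q δ n : ℂ) =
      ((∑' k : ℕ, ((k + 1 : ℕ) : ℝ) ^ (q - 1) * Real.exp (-(δ * (k + 1 : ℕ))) : ℝ) : ℂ) := by
    rw [Complex.ofReal_tsum]
    have hinj : Function.Injective fun k : ℕ => ((k + 1 : ℕ) : ℤ) := fun a b h => by
      simpa using h
    rw [← hinj.tsum_eq]
    · refine tsum_congr fun k => ?_
      rw [gammaKernel_of_pos (by positivity)]
      push_cast
      rfl
    · intro n hn
      have : 0 < n := by
        by_contra h
        refine hn ?_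
        simp only
        rw [gammaKernel_of_nonpos hq (by exact_mod_cast not_lt.1 h), Complex.ofReal_zero]
      exact ⟨(n - 1).toNat, by simp; omega⟩
  rw [hL, hFs.tsum_eq_add_tsum_ite 0] at hP
  have h0 : (1 / (δ + 2 * Real.pi * ((0 : ℤ) : ℝ) * Complex.I)) ^ (q : ℂ) * Real.Gamma q =
      ((Real.Gamma q * δ ^ (-q) : ℝ) : ℂ) := by
    rw [Real.rpow_neg hδ.le, ← Real.inv_rpow hδ.le, Complex.ofReal_mul,
      Complex.ofReal_cpow (by positivity)]
    push_cast
    simp [mul_comm]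
  rw [h0, ← sub_eq_iff_eq_add', ← Complex.ofReal_sub] at hP
  rw [← Real.norm_eq_abs, ← Complex.norm_real, hP]
  refine tsum_of_norm_bounded (hsum.mul_right _).hasSum fun n => ?_
  split_ifs with hn
  · simp only [norm_zero]
    positivity
  · exact hF n hn

/-! ### Sums `∑ k ^ (q - 1) exp (- δ k)` up to bounded errors -/

theorem antitoneOn_rpow_mul_exp_neg {q δ : ℝ} (hq : q ≤ 1) (hδ : 0 < δ) :
    AntitoneOn (fun x : ℝ => x ^ (q - 1) * Real.exp (-(δ * x))) (Set.Ioi 0) := by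
  intro x hx y hy hxy
  have hx' : 0 < x := hx
  exact mul_le_mul (Real.rpow_le_rpow_of_nonpos hx' hxy (by linarith))
    (Real.exp_le_exp.2 (by nlinarith)) (Real.exp_nonneg _) (Real.rpow_nonneg hx'.le _)

theorem setIntegral_Ioc_rpow_mul_exp_neg_le {q δ : ℝ} (hq : 0 < q) (hδ : 0 < δ) :
    ∫ x in Set.Ioc (0 : ℝ) 1, x ^ (q - 1) * Real.exp (-(δ * x)) ≤ 1 / q := by
  have h : ∫ x in Set.Ioc (0 : ℝ) 1, x ^ (q - 1) = 1 / q := by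
    rw [← intervalIntegral.integral_of_le zero_le_one, integral_rpow (Or.inl (by linarith))]
    simp [hq.ne']
  rw [← h]
  refine setIntegral_mono_on
    ((integrableOn_rpow_mul_exp_neg hq hδ).mono_set Set.Ioc_subset_Ioi_self) ?_
    measurableSet_Ioc fun x hx => ?_
  · exact (intervalIntegrable_iff_integrableOn_Ioc_of_le zero_le_one).1
      (intervalIntegral.intervalIntegrable_rpow' (by linarith))
  · refine mul_le_of_le_one_right (Real.rpow_nonneg hx.1.le _) (Real.exp_le_one_iff.2 ?_)
    have := mul_pos hδ hx.1
    linarith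

/-- `∑ k ^ (q - 1) exp (- δ k) = Γ(q) δ ^ (- q) + O(1)` for `0 < q ≤ 1`, by comparing the sum of a
decreasing function with its integral. -/
theorem tsum_sub_Gamma_le_of_le_one {q δ : ℝ} (hq : 0 < q) (hq1 : q ≤ 1) (hδ : 0 < δ) :
    |∑' k : ℕ, ((k + 1 : ℕ) : ℝ) ^ (q - 1) * Real.exp (-(δ * (k + 1 : ℕ))) -
      Real.Gamma q * δ ^ (-q)| ≤ 1 + 1 / q := by
  set f : ℝ → ℝ := fun x => x ^ (q - 1) * Real.exp (-(δ * x)) with hf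
  have hint := integrableOn_rpow_mul_exp_neg hq hδ
  have hf0 : ∀ x, 0 < x → 0 ≤ f x := fun x hx => by simp only [hf]; positivity
  have hf1 : f 1 ≤ 1 := by
    simp only [hf, Real.one_rpow, one_mul]
    exact Real.exp_le_one_iff.2 (by linarith)
  have hanti : ∀ M : ℕ, AntitoneOn f (Set.Icc ((1 : ℕ) : ℝ) (M : ℕ)) := fun M =>
    (antitoneOn_rpow_mul_exp_neg hq1 hδ).mono fun x hx =>
      lt_of_lt_of_le (by norm_num) hx.1
  have hS := (summable_rpow_mul_exp_neg q hδ).hasSum.tendsto_sum_nat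
  have hI : Tendsto (fun M : ℕ => ∫ x in ((1 : ℕ) : ℝ)..((M + 1 : ℕ) : ℝ), f x) atTop
      (𝓝 (∫ x in Set.Ioi (1 : ℝ), f x)) := by
    rw [Nat.cast_one]
    refine intervalIntegral_tendsto_integral_Ioi 1
      (hint.mono_set (Set.Ioi_subset_Ioi zero_le_one)) ?_
    exact tendsto_natCast_atTop_atTop.comp (tendsto_add_atTop_nat 1)
  have hsplit : ∫ x in Set.Ioi (0 : ℝ), f x =
      (∫ x in Set.Ioc (0 : ℝ) 1, f x) + ∫ x in Set.Ioi (1 : ℝ), f x := by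
    rw [← setIntegral_union (Set.Ioc_disjoint_Ioi le_rfl) measurableSet_Ioi
      (hint.mono_set Set.Ioc_subset_Ioi_self)
      (hint.mono_set (Set.Ioi_subset_Ioi zero_le_one)), Set.Ioc_union_Ioi_eq_Ioi zero_le_one]
  have hG : ∫ x in Set.Ioi (0 : ℝ), f x = Real.Gamma q * δ ^ (-q) := by
    rw [hf, Real.integral_rpow_mul_exp_neg_mul_Ioi hq hδ, one_div, Real.inv_rpow hδ.le,
      Real.rpow_neg hδ.le, mul_comm]
  have hsmall := setIntegral_Ioc_rpow_mul_exp_neg_le hq hδ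
  have hsmall0 : 0 ≤ ∫ x in Set.Ioc (0 : ℝ) 1, f x :=
    setIntegral_nonneg measurableSet_Ioc fun x hx => hf0 x hx.1
  have hreindex : ∀ M : ℕ, ∑ i ∈ Finset.range M, f ((i + 1 : ℕ) : ℝ) =
      ∑ i ∈ Finset.Ico 1 (M + 1), f (i : ℝ) := fun M => by
    rw [Finset.range_eq_Ico, Finset.sum_Ico_add' (fun i : ℕ => f (i : ℝ)) 0 M 1]
  -- Only `[1, ∞)` is compared with the sum, as `f` may be unbounded near `0`.
  have hlow : ∫ x in Set.Ioi (1 : ℝ), f x ≤ ∑' k : ℕ, f ((k + 1 : ℕ) : ℝ) := by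
    refine le_of_tendsto_of_tendsto' hI hS fun M => ?_
    rw [hreindex]
    exact AntitoneOn.integral_le_sum_Ico (by omega) (hanti _)
  have hup : ∑' k : ℕ, f ((k + 1 : ℕ) : ℝ) ≤ 1 + ∫ x in Set.Ioi (1 : ℝ), f x := by
    refine le_of_tendsto_of_tendsto' (hS.comp (tendsto_add_atTop_nat 1))
      (tendsto_const_nhds.add hI) fun M => ?_
    have h1 := AntitoneOn.sum_le_integral_Ico (f := f) (a := 1) (b := M + 1) (by omega) (hanti _)
    rw [Finset.sum_Ico_add' (fun i : ℕ => f (i : ℝ)) 1 (M + 1) 1] at h1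
    simp only [Function.comp]
    rw [hreindex, Finset.sum_eq_sum_Ico_succ_bot (by omega)]
    exact add_le_add (by simpa using hf1) h1
  rw [abs_le]
  have hq' : 0 < 1 / q := by positivity
  constructor <;> linarith

theorem exists_tsum_sub_Gamma_le {q : ℝ} (hq : 0 < q) :
    ∃ C : ℝ, ∀ δ : ℝ, 0 < δ →
      |∑' k : ℕ, ((k + 1 : ℕ) : ℝ) ^ (q - 1) * Real.exp (-(δ * (k + 1 : ℕ))) -
        Real.Gamma q * δ ^ (-q)| ≤ C := by
  rcases lt_or_ge 1 q with h | h
  · exact exists_tsum_sub_Gamma_le_of_one_lt h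
  · exact ⟨1 + 1 / q, fun δ hδ => tsum_sub_Gamma_le_of_le_one hq h hδ⟩

/-- The truncated sum `∑_{k ≤ N} k ^ (q - 1) exp (- δ k)`. -/
noncomputable def truncSum (q δ : ℝ) (N : ℕ) : ℝ :=
  ∑ k ∈ Finset.Icc 1 N, (k : ℝ) ^ (q - 1) * Real.exp (-(δ * k))

theorem truncSum_eq_sum_range (q δ : ℝ) (N : ℕ) : truncSum q δ N =
    ∑ k ∈ Finset.range N, ((k + 1 : ℕ) : ℝ) ^ (q - 1) * Real.exp (-(δ * (k + 1 : ℕ))) := by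
  rw [Finset.range_eq_Ico, Finset.sum_Ico_add'
    (fun k : ℕ => (k : ℝ) ^ (q - 1) * Real.exp (-(δ * k))) 0 N 1]
  rfl

/-- The terms beyond `N` are at most `exp (- δ N / 2)` times those with `δ / 2` in place of `δ`. -/
theorem tsum_sub_truncSum_le (q : ℝ) {δ : ℝ} (hδ : 0 < δ) (N : ℕ) :
    |∑' k : ℕ, ((k + 1 : ℕ) : ℝ) ^ (q - 1) * Real.exp (-(δ * (k + 1 : ℕ))) - truncSum q δ N| ≤
      Real.exp (-(δ * N / 2)) *
        ∑' k : ℕ, ((k + 1 : ℕ) : ℝ) ^ (q - 1) * Real.exp (-(δ / 2 * (k + 1 : ℕ))) := by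
  have h1 := summable_rpow_mul_exp_neg q hδ
  have h2 := summable_rpow_mul_exp_neg q (half_pos hδ)
  rw [truncSum_eq_sum_range, ← h1.sum_add_tsum_nat_add N, add_sub_cancel_left,
    abs_of_nonneg (tsum_nonneg fun k => by positivity), ← tsum_mul_left]
  refine le_trans ?_ (((h2.mul_left (Real.exp (-(δ * N / 2)))).sum_add_tsum_nat_add N).le.trans'
    (le_add_of_nonneg_left (Finset.sum_nonneg fun k _ => by positivity)))
  refine Summable.tsum_le_tsum (fun k => ?_) ((summable_nat_add_iff N).2 h1)
    ((summable_nat_add_iff N).2 (h2.mul_left _))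
  rw [mul_left_comm, ← Real.exp_add]
  gcongr
  push_cast
  have : (0 : ℝ) ≤ (k : ℝ) + 1 := by positivity
  nlinarith

theorem exists_truncSum_sub_Gamma_le {q : ℝ} (hq : 0 < q) :
    ∃ C : ℝ, 0 ≤ C ∧ ∀ δ : ℝ, 0 < δ → ∀ N : ℕ,
      |truncSum q δ N - Real.Gamma q * δ ^ (-q)| ≤
        C * (1 + Real.exp (-(δ * N / 2)) * δ ^ (-q)) := by
  obtain ⟨C, hC⟩ := exists_tsum_sub_Gamma_le hq
  have hC0 : 0 ≤ C := (abs_nonneg _).trans (hC 1 one_pos)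
  have hΓ := (Real.Gamma_pos_of_pos hq).le
  set D := Real.Gamma q * (1 / 2 : ℝ) ^ (-q) with hD
  have hD0 : 0 ≤ D := by positivity
  refine ⟨2 * C + D, by positivity, fun δ hδ N => ?_⟩
  have h1 := hC δ hδ
  have h2 := (abs_le.1 (hC (δ / 2) (half_pos hδ))).2
  have h3 := tsum_sub_truncSum_le q hδ N
  have he1 : Real.exp (-(δ * N / 2)) ≤ 1 := Real.exp_le_one_iff.2 (by
    have : 0 ≤ δ * N := by positivity
    linarith)
  have he0 := Real.exp_pos (-(δ * N / 2))
  have hd : Real.Gamma q * (δ / 2) ^ (-q) = D * δ ^ (-q) := by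
    rw [hD, div_eq_mul_one_div, Real.mul_rpow hδ.le (by norm_num)]
    ring
  have hdp : 0 < δ ^ (-q) := by positivity
  have h4 := h3.trans (mul_le_mul_of_nonneg_left (sub_le_iff_le_add.1 h2) he0.le)
  rw [hd] at h4
  rw [abs_sub_comm] at h4
  refine (abs_sub_le _ _ _).trans ((add_le_add h4 h1).trans ?_)
  have h5 : Real.exp (-(δ * N / 2)) * C ≤ C := mul_le_of_le_one_left hC0 he1
  have h6 : 0 ≤ C * (Real.exp (-(δ * N / 2)) * δ ^ (-q)) := by positivity
  nlinarith

/-! ### Decay of the characteristic function -/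

theorem one_sub_cos_sub_le (x y : ℝ) :
    1 - Real.cos (x - y) ≤ 2 * ((1 - Real.cos x) + (1 - Real.cos y)) := by
  rw [Real.cos_sub]
  nlinarith [sq_nonneg (Real.cos x + Real.cos y - 2), sq_nonneg (Real.sin x + Real.sin y),
    Real.sin_sq_add_cos_sq x, Real.sin_sq_add_cos_sq y]

theorem sum_cos_le {θ : ℝ} (s : ℝ) (hθ0 : θ ≠ 0) (hθ : |θ| ≤ Real.pi) (n : ℕ) :
    ∑ j ∈ Finset.range n, Real.cos (s + j * θ) ≤ Real.pi / |θ| := by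
  have hpos : 0 < |θ| := abs_pos.2 hθ0
  have hlow : 2 * |θ| / Real.pi ≤ ‖Complex.exp (Complex.I * θ) - 1‖ := by
    rw [Complex.norm_exp_I_mul_ofReal_sub_one, norm_mul, Real.norm_eq_abs, Real.norm_eq_abs,
      abs_two]
    have h1 := Real.mul_abs_le_abs_sin (x := θ / 2) (by rw [abs_div, abs_two]; linarith)
    rw [abs_div, abs_two] at h1
    calc 2 * |θ| / Real.pi = 2 * (2 / Real.pi * (|θ| / 2)) := by ring
      _ ≤ _ := by linarith
  have hne : Complex.exp (Complex.I * θ) ≠ 1 := fun h => by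
    rw [h, sub_self, norm_zero] at hlow
    have : 0 < 2 * |θ| / Real.pi := by positivity
    linarith
  have h1 : ∑ j ∈ Finset.range n, Real.cos (s + j * θ) =
      (Complex.exp (Complex.I * s) *
        ∑ j ∈ Finset.range n, Complex.exp (Complex.I * θ) ^ j).re := by
    rw [Finset.mul_sum, Complex.re_sum]
    refine Finset.sum_congr rfl fun j _ => ?_
    rw [← Complex.exp_nat_mul, ← Complex.exp_add, ← Complex.exp_ofReal_mul_I_re]
    congr 2
    push_cast
    ring
  rw [h1]
  refine (Complex.re_le_norm _).trans ?_
  rw [norm_mul, Complex.norm_exp_I_mul_ofReal, one_mul, geom_sum_eq hne, norm_div,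
    div_le_div_iff₀ (lt_of_lt_of_le (by positivity) hlow) hpos]
  have h2 : ‖Complex.exp (Complex.I * θ) ^ n - 1‖ ≤ 2 := by
    refine (norm_sub_le _ _).trans ?_
    rw [norm_pow, Complex.norm_exp_I_mul_ofReal]
    norm_num
  calc _ ≤ 2 * |θ| := by gcongr
    _ = Real.pi * (2 * |θ| / Real.pi) := by field_simp
    _ ≤ _ := by gcongr

/-- A lower bound that does not depend on the phase `s`: for small `θ` the phase cancels between
the `j`-th and the `(j + M)`-th term, for large `θ` the cosines are a geometric sum. -/
theorem le_sum_one_sub_cos (s : ℝ) {θ : ℝ} (hθ : |θ| ≤ Real.pi) (M : ℕ) :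
    M * min 1 ((M * θ) ^ 2 / Real.pi ^ 2) ≤
      ∑ j ∈ Finset.range (2 * M), (1 - Real.cos (s + j * θ)) := by
  rcases le_or_gt (M * |θ|) Real.pi with h | h
  · rw [two_mul, Finset.sum_range_add, ← Finset.sum_add_distrib]
    refine (mul_le_mul_of_nonneg_left (min_le_right _ _) (Nat.cast_nonneg M)).trans ?_
    have hconst : M * ((M * θ) ^ 2 / Real.pi ^ 2) =
        ∑ _j ∈ Finset.range M, (M * θ) ^ 2 / Real.pi ^ 2 := by simp
    rw [hconst]
    refine Finset.sum_le_sum fun j _ => ?_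
    have h1 := one_sub_cos_sub_le (s + ((M + j : ℕ) : ℝ) * θ) (s + j * θ)
    rw [show s + ((M + j : ℕ) : ℝ) * θ - (s + j * θ) = M * θ by push_cast; ring] at h1
    have h3 := Real.cos_le_one_sub_mul_cos_sq (x := M * θ)
      (by rw [abs_mul, Nat.abs_cast]; exact h)
    have h4 : 2 / Real.pi ^ 2 * (M * θ) ^ 2 = 2 * ((M * θ) ^ 2 / Real.pi ^ 2) := by ring
    linarith
  · have hθ0 : θ ≠ 0 := by
      rintro rfl
      rw [abs_zero, mul_zero] at h
      linarith [Real.pi_pos]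
    have h1 := sum_cos_le s hθ0 hθ (2 * M)
    have h2 : Real.pi / |θ| ≤ M := (div_le_iff₀ (abs_pos.2 hθ0)).2 h.le
    have h3 := mul_le_mul_of_nonneg_left (min_le_left 1 ((M * θ) ^ 2 / Real.pi ^ 2))
      (Nat.cast_nonneg (α := ℝ) M)
    rw [Finset.sum_sub_distrib]
    simp only [Finset.sum_const, Finset.card_range, nsmul_eq_mul, Nat.cast_mul, Nat.cast_ofNat]
    linarith

theorem le_rpow_mul_exp_neg {p δ x : ℝ} (hδ : 0 < δ) (hx1 : 1 / δ ≤ x) (hx6 : x ≤ 6 / δ) :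
    Real.exp (-6) * min 1 (6 ^ (p - 1)) * δ ^ (1 - p) ≤ x ^ (p - 1) * Real.exp (-(δ * x)) := by
  have hx0 : 0 < x := lt_of_lt_of_le (by positivity) hx1
  have h1 : Real.exp (-6) ≤ Real.exp (-(δ * x)) := by
    have : x * δ ≤ 6 := (le_div_iff₀ hδ).1 hx6
    exact Real.exp_le_exp.2 (by linarith)
  have hd : δ ^ (1 - p) = (1 / δ) ^ (p - 1) := by
    rw [one_div, Real.inv_rpow hδ.le, ← Real.rpow_neg hδ.le, neg_sub]
  have hd0 : 0 < (1 / δ) ^ (p - 1) := by positivity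
  have h2 : min 1 (6 ^ (p - 1)) * δ ^ (1 - p) ≤ x ^ (p - 1) := by
    rw [hd]
    rcases le_total 1 p with hp | hp
    · refine (mul_le_of_le_one_left hd0.le (min_le_left _ _)).trans ?_
      exact Real.rpow_le_rpow (by positivity) hx1 (by linarith)
    · refine (mul_le_mul_of_nonneg_right (min_le_right _ _) hd0.le).trans ?_
      rw [← Real.mul_rpow (by norm_num) (by positivity), mul_one_div]
      exact Real.rpow_le_rpow_of_nonpos hx0 hx6 (by linarith)
  calc _ = (min 1 (6 ^ (p - 1)) * δ ^ (1 - p)) * Real.exp (-6) := by ring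
    _ ≤ _ := mul_le_mul h2 h1 (Real.exp_nonneg _) (by positivity)

/-- The decay of the characteristic function away from the origin, uniformly in the phase `s`.
Only the indices `k` of order `1 / δ` are used. -/
theorem exists_le_sum_one_sub_cos (p : ℝ) : ∃ c : ℝ, 0 < c ∧ ∀ δ : ℝ, 0 < δ → δ ≤ 1 →
    ∀ N : ℕ, 6 ≤ δ * N → ∀ s θ : ℝ, |θ| ≤ Real.pi →
      c * δ ^ (-p) * min 1 ((θ / δ) ^ 2) ≤
        ∑ k ∈ Finset.Icc 1 N,
          (k : ℝ) ^ (p - 1) * Real.exp (-(δ * k)) * (1 - Real.cos (s + k * θ)) := by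
  set c₀ := Real.exp (-6) * min 1 (6 ^ (p - 1)) with hc₀
  have hc₀pos : 0 < c₀ := by positivity
  refine ⟨c₀ / Real.pi ^ 2, by positivity, fun δ hδ hδ1 N hN s θ hθ => ?_⟩
  set M := ⌈1 / δ⌉₊ with hM
  have hMl : 1 / δ ≤ M := Nat.le_ceil _
  have hMu : (M : ℝ) ≤ 2 / δ := by
    have h1 := (Nat.ceil_lt_add_one (show 0 ≤ 1 / δ by positivity)).le
    have h2 : 1 ≤ 1 / δ := (one_le_div hδ).2 hδ1
    have h3 : 2 / δ = 1 / δ + 1 / δ := by ring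
    rw [h3]
    linarith
  have hMN : 3 * M ≤ N := by
    have h1 : (6 : ℝ) / δ ≤ N := (div_le_iff₀ hδ).2 (by linarith)
    have h2 : (6 : ℝ) / δ = 3 * (2 / δ) := by ring
    have h3 : ((3 * M : ℕ) : ℝ) ≤ N := by
      push_cast
      linarith
    exact_mod_cast h3
  have hcos : ∀ x : ℝ, 0 ≤ 1 - Real.cos x := fun x => sub_nonneg.2 (Real.cos_le_one x)
  have hblock : c₀ * δ ^ (1 - p) *
      ∑ j ∈ Finset.range (2 * M), (1 - Real.cos ((s + (M + 1 : ℕ) * θ) + j * θ)) ≤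
      ∑ k ∈ Finset.Icc 1 N,
          (k : ℝ) ^ (p - 1) * Real.exp (-(δ * k)) * (1 - Real.cos (s + k * θ)) := by
    rw [Finset.mul_sum]
    calc _ ≤ ∑ j ∈ Finset.range (2 * M), ((j + (M + 1) : ℕ) : ℝ) ^ (p - 1) *
          Real.exp (-(δ * (j + (M + 1) : ℕ))) * (1 - Real.cos (s + (j + (M + 1) : ℕ) * θ)) := by
          refine Finset.sum_le_sum fun j hj => ?_
          have hj' : j + 1 ≤ 2 * M := Finset.mem_range.1 hj
          have hj2 : (j : ℝ) + 1 ≤ 2 * M := by exact_mod_cast hj'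
          rw [show s + (M + 1 : ℕ) * θ + j * θ = s + (j + (M + 1) : ℕ) * θ by push_cast; ring]
          refine mul_le_mul_of_nonneg_right (le_rpow_mul_exp_neg hδ ?_ ?_) (hcos _)
          · push_cast
            linarith [Nat.cast_nonneg (α := ℝ) j]
          · have : (6 : ℝ) / δ = 3 * (2 / δ) := by ring
            push_cast
            linarith
      _ = ∑ k ∈ Finset.Ico (0 + (M + 1)) (2 * M + (M + 1)), (k : ℝ) ^ (p - 1) *
          Real.exp (-(δ * k)) * (1 - Real.cos (s + k * θ)) := by
          rw [Finset.range_eq_Ico, Finset.sum_Ico_add' (fun k : ℕ => (k : ℝ) ^ (p - 1) *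
            Real.exp (-(δ * k)) * (1 - Real.cos (s + k * θ)))]
      _ ≤ _ := by
          refine Finset.sum_le_sum_of_subset_of_nonneg (fun k hk => ?_) fun k _ _ =>
            mul_nonneg (by positivity) (hcos _)
          have := Finset.mem_Ico.1 hk
          exact Finset.mem_Icc.2 ⟨by omega, by omega⟩
  refine le_trans ?_ hblock
  have h1 := le_sum_one_sub_cos (s + (M + 1 : ℕ) * θ) hθ M
  have hpi : 1 ≤ Real.pi ^ 2 := by nlinarith [Real.pi_gt_three]
  have h2 : min 1 ((θ / δ) ^ 2) / Real.pi ^ 2 ≤ min 1 ((M * θ) ^ 2 / Real.pi ^ 2) := by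
    refine le_min ?_ ?_
    · exact (div_le_one (by positivity)).2 ((min_le_left _ _).trans hpi)
    · gcongr
      refine (min_le_right _ _).trans ?_
      rw [mul_pow, div_pow, div_eq_mul_one_div, mul_comm]
      gcongr
      rw [← one_div_pow]
      gcongr
  have h3 : δ ^ (-p) = δ ^ (1 - p) * (1 / δ) := by
    rw [show -p = 1 - p - 1 by ring, Real.rpow_sub_one hδ.ne']
    ring
  calc c₀ / Real.pi ^ 2 * δ ^ (-p) * min 1 ((θ / δ) ^ 2)
      = c₀ * δ ^ (1 - p) * ((1 / δ) * (min 1 ((θ / δ) ^ 2) / Real.pi ^ 2)) := by rw [h3]; ring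
    _ ≤ c₀ * δ ^ (1 - p) * (M * min 1 ((M * θ) ^ 2 / Real.pi ^ 2)) := by gcongr
    _ ≤ _ := by gcongr

/-! ### The saddle point and the Gaussian limit -/

/-- The saddle point: the solution `δ` of `Γ(p + 1) δ ^ (-(p + 1)) = N`. -/
noncomputable def saddle (p : ℝ) (N : ℕ) : ℝ := (Real.Gamma (p + 1) / N) ^ (1 / (p + 1))

section saddle

variable {p : ℝ}

theorem saddle_pos (hp : 0 < p) {N : ℕ} (hN : 1 ≤ N) : 0 < saddle p N := by
  have := Real.Gamma_pos_of_pos (show 0 < p + 1 by linarith)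
  have hN' : (0 : ℝ) < N := by exact_mod_cast hN
  unfold saddle
  positivity

theorem tendsto_saddle (hp : 0 < p) : Tendsto (saddle p) atTop (𝓝 0) := by
  have h1 : Tendsto (fun N : ℕ => Real.Gamma (p + 1) / N) atTop (𝓝 0) :=
    tendsto_const_div_atTop_nhds_zero_nat _
  have h2 : 0 < 1 / (p + 1) := by positivity
  have := h1.rpow_const (p := 1 / (p + 1)) (Or.inr h2.le)
  rwa [Real.zero_rpow h2.ne'] at this

theorem eventually_saddle_pos (hp : 0 < p) : ∀ᶠ N in atTop, 0 < saddle p N := by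
  filter_upwards [eventually_ge_atTop 1] with N hN using saddle_pos hp hN

theorem tendsto_saddle_nhdsGT (hp : 0 < p) : Tendsto (saddle p) atTop (𝓝[>] 0) :=
  tendsto_nhdsWithin_iff.2 ⟨tendsto_saddle hp, eventually_saddle_pos hp⟩

theorem saddle_rpow_neg (hp : 0 < p) (N : ℕ) (x : ℝ) :
    saddle p N ^ (-x) = (N / Real.Gamma (p + 1)) ^ (x / (p + 1)) := by
  have := Real.Gamma_pos_of_pos (show 0 < p + 1 by linarith)
  rw [saddle, ← Real.rpow_mul (by positivity), ← inv_div, Real.inv_rpow (by positivity),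
    ← Real.rpow_neg (by positivity)]
  congr 1
  ring

theorem Gamma_mul_saddle_rpow (hp : 0 < p) (N : ℕ) :
    Real.Gamma (p + 1) * saddle p N ^ (-(p + 1)) = N := by
  have := Real.Gamma_pos_of_pos (show 0 < p + 1 by linarith)
  rw [saddle_rpow_neg hp, div_self (by linarith), Real.rpow_one]
  field_simp

theorem saddle_mul_self (hp : 0 < p) {N : ℕ} (hN : 1 ≤ N) :
    saddle p N * N = Real.Gamma (p + 1) * saddle p N ^ (-p) := by
  have h := saddle_pos hp hN
  have h1 : saddle p N ^ (-p) = saddle p N * saddle p N ^ (-(p + 1)) := by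
    rw [show -p = 1 + -(p + 1) by ring, Real.rpow_add h, Real.rpow_one]
  rw [h1]
  conv_lhs => rw [← Gamma_mul_saddle_rpow hp N]
  ring

theorem tendsto_rpow_saddle (hp : 0 < p) {x : ℝ} (hx : 0 < x) :
    Tendsto (fun N => saddle p N ^ x) atTop (𝓝 0) := by
  have := (tendsto_saddle hp).rpow_const (p := x) (Or.inr hx.le)
  rwa [Real.zero_rpow hx.ne'] at this

theorem tendsto_rpow_neg_saddle (hp : 0 < p) {x : ℝ} (hx : 0 < x) :
    Tendsto (fun N => saddle p N ^ (-x)) atTop atTop :=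
  (tendsto_rpow_neg_nhdsGT_zero (by linarith)).comp (tendsto_saddle_nhdsGT hp)

theorem Q_mul_rpow (hp : 0 < p) (N : ℕ) :
    CoagFrag.Q p * (N : ℝ) ^ (p / (p + 1)) = Real.Gamma p * saddle p N ^ (-p) := by
  have hΓ := Real.Gamma_pos_of_pos (show 0 < p + 1 by linarith)
  rw [saddle_rpow_neg hp, Real.div_rpow (Nat.cast_nonneg N) hΓ.le, CoagFrag.Q]
  have h : Real.Gamma (p + 1) ^ (1 / (p + 1)) * Real.Gamma (p + 1) ^ (p / (p + 1)) =
      p * Real.Gamma p := by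
    rw [← Real.rpow_add hΓ, ← add_div, add_comm 1 p, div_self (by linarith), Real.rpow_one,
      Real.Gamma_add_one hp.ne']
  have h2 : 0 < Real.Gamma (p + 1) ^ (p / (p + 1)) := by positivity
  field_simp
  linear_combination (N : ℝ) ^ (p / (p + 1)) * h

theorem sqrt_d_mul_rpow (hp : 0 < p) {N : ℕ} (hN : 1 ≤ N) :
    Real.sqrt (CoagFrag.d p) * (N : ℝ) ^ (p / (2 * p + 2)) =
      Real.sqrt (Real.Gamma p / (p + 1)) * saddle p N ^ (-(p / 2)) := by
  have hδ := saddle_pos hp hN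
  have hΓ := Real.Gamma_pos_of_pos (show 0 < p + 1 by linarith)
  have hΓ' := Real.Gamma_pos_of_pos hp
  have h1 : (N : ℝ) ^ (p / (2 * p + 2)) = Real.sqrt ((N : ℝ) ^ (p / (p + 1))) := by
    rw [Real.sqrt_eq_rpow, ← Real.rpow_mul (Nat.cast_nonneg N)]
    congr 1
    field_simp
  have h2 : saddle p N ^ (-(p / 2)) = Real.sqrt (saddle p N ^ (-p)) := by
    rw [Real.sqrt_eq_rpow, ← Real.rpow_mul hδ.le]
    congr 1
    ring
  rw [h1, h2, ← Real.sqrt_mul' _ (by positivity), ← Real.sqrt_mul' _ (by positivity)]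
  congr 1
  rw [CoagFrag.d, div_mul_eq_mul_div, Q_mul_rpow hp]
  ring

/-- At the saddle point the truncation at `N` costs nothing: the tail is exponentially small. -/
theorem exists_truncSum_saddle_sub_le (hp : 0 < p) {q : ℝ} (hq : 0 < q) :
    ∃ C : ℝ, ∀ᶠ N in atTop,
      |truncSum q (saddle p N) N - Real.Gamma q * saddle p N ^ (-q)| ≤ C := by
  obtain ⟨C, hC0, hC⟩ := exists_truncSum_sub_Gamma_le hq
  have hΓ := Real.Gamma_pos_of_pos (show 0 < p + 1 by linarith)
  have h1 := (tendsto_rpow_mul_exp_neg_mul_atTop_nhds_zero (q / p) (Real.Gamma (p + 1) / 2)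
    (by positivity)).comp (tendsto_rpow_neg_saddle hp hp)
  refine ⟨C * (1 + 1), ?_⟩
  filter_upwards [h1.eventually (eventually_le_nhds zero_lt_one), eventually_ge_atTop 1]
    with N hN hN1
  refine (hC _ (saddle_pos hp hN1) N).trans ?_
  gcongr
  refine le_of_eq_of_le ?_ hN
  have hδ := saddle_pos hp hN1
  simp only [Function.comp]
  rw [saddle_mul_self hp hN1, ← Real.rpow_mul hδ.le, mul_comm]
  congr 2
  · field_simp
  · ring

theorem tendsto_mul_truncSum_sub (hp : 0 < p) {q x : ℝ} (hq : 0 < q) (hx : 0 < x) :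
    Tendsto (fun N => saddle p N ^ x *
      (truncSum q (saddle p N) N - Real.Gamma q * saddle p N ^ (-q))) atTop (𝓝 0) := by
  obtain ⟨C, hC⟩ := exists_truncSum_saddle_sub_le hp hq
  have h := tendsto_rpow_saddle hp hx
  exact h.zero_mul_isBoundedUnder_le ⟨C, by simpa using hC⟩

theorem tendsto_mul_truncSum (hp : 0 < p) {q : ℝ} (hq : 0 < q) :
    Tendsto (fun N => saddle p N ^ q * truncSum q (saddle p N) N) atTop (𝓝 (Real.Gamma q)) := by
  have h := (tendsto_mul_truncSum_sub hp hq hq).add_const (Real.Gamma q)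
  rw [zero_add] at h
  refine h.congr' ?_
  filter_upwards [eventually_saddle_pos hp] with N hN
  have : saddle p N ^ q * saddle p N ^ (-q) = 1 := by
    rw [← Real.rpow_add hN, add_neg_cancel, Real.rpow_zero]
  linear_combination (-Real.Gamma q) * this

end saddle

theorem norm_cexp_mul_I_sub_le (x : ℝ) :
    ‖Complex.exp (x * Complex.I) - 1 - x * Complex.I + (x : ℂ) ^ 2 / 2‖ ≤ 4 * |x| ^ 3 := by
  have hn : ‖(x * Complex.I : ℂ)‖ = |x| := by simp
  rcases le_total |x| 1 with h | h
  · have h1 := Complex.norm_exp_sub_sum_le_norm_mul_exp (x * Complex.I) 3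
    rw [hn] at h1
    have h2 : Complex.exp (x * Complex.I) -
        ∑ m ∈ Finset.range 3, (x * Complex.I) ^ m / m.factorial =
        Complex.exp (x * Complex.I) - 1 - x * Complex.I + (x : ℂ) ^ 2 / 2 := by
      simp [Finset.sum_range_succ, mul_pow]
      ring
    rw [h2] at h1
    refine h1.trans ?_
    rw [mul_comm]
    gcongr
    have := Real.exp_one_lt_d9
    have := Real.exp_le_exp.2 h
    linarith
  · have h1 : ‖Complex.exp (x * Complex.I) - 1 - x * Complex.I + (x : ℂ) ^ 2 / 2‖ ≤
        1 + 1 + |x| + |x| ^ 2 / 2 := by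
      refine (norm_add_le _ _).trans (add_le_add ((norm_sub_le _ _).trans (add_le_add
        ((norm_sub_le _ _).trans (add_le_add ?_ ?_)) hn.le)) ?_)
      · rw [Complex.norm_exp_ofReal_mul_I]
      · simp
      · simp
    nlinarith [mul_le_mul h h zero_le_one (abs_nonneg x), abs_nonneg x,
      mul_nonneg (sub_nonneg.2 h) (sq_nonneg |x|), mul_nonneg (sub_nonneg.2 h) (abs_nonneg x)]

/-- The tilted parameters `k ^ (p - 1) exp (- δ k)`. -/
noncomputable def tiltedParam (p δ : ℝ) (k : ℕ) : ℝ := (k : ℝ) ^ (p - 1) * Real.exp (-(δ * k))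

theorem tiltedParam_nonneg (p δ : ℝ) (k : ℕ) : 0 ≤ tiltedParam p δ k := by
  unfold tiltedParam
  positivity

/-- The logarithm of the centred joint characteristic function at `(s, θ)` of `(∑ Z k, ∑ k Z k)`,
where the `Z k`, `1 ≤ k ≤ N`, are independent Poisson variables with means
`tiltedParam p (saddle p N) k`, and the centring is at `(Γ(p) δ ^ (-p), N)`, `δ = saddle p N`. -/
noncomputable def logCharFun (p : ℝ) (N : ℕ) (s θ : ℝ) : ℂ :=
  (∑ k ∈ Finset.Icc 1 N, (tiltedParam p (saddle p N) k : ℂ) *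
    (Complex.exp ((s + k * θ : ℝ) * Complex.I) - 1)) -
    ((s * (Real.Gamma p * saddle p N ^ (-p)) + θ * N : ℝ) : ℂ) * Complex.I

theorem truncSum_add_nat (p δ : ℝ) (N j : ℕ) : truncSum (p + j) δ N =
    ∑ k ∈ Finset.Icc 1 N, tiltedParam p δ k * (k : ℝ) ^ j := by
  refine Finset.sum_congr rfl fun k hk => ?_
  have hk' : (0 : ℝ) < k := by exact_mod_cast (Finset.mem_Icc.1 hk).1
  rw [tiltedParam, show p + j - 1 = (p - 1) + j by ring, Real.rpow_add hk', Real.rpow_natCast]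
  ring

theorem norm_logCharFun_sub_le (p : ℝ) (N : ℕ) (s θ : ℝ) :
    ‖logCharFun p N s θ -
      (((s * (truncSum p (saddle p N) N - Real.Gamma p * saddle p N ^ (-p)) +
          θ * (truncSum (p + 1) (saddle p N) N - N) : ℝ) : ℂ) * Complex.I -
        ((s ^ 2 * truncSum p (saddle p N) N + 2 * s * θ * truncSum (p + 1) (saddle p N) N +
          θ ^ 2 * truncSum (p + 2) (saddle p N) N : ℝ) : ℂ) / 2)‖ ≤
      16 * (|s| ^ 3 * truncSum p (saddle p N) N + |θ| ^ 3 * truncSum (p + 3) (saddle p N) N) := by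
  have h0 := truncSum_add_nat p (saddle p N) N 0
  have h1 := truncSum_add_nat p (saddle p N) N 1
  have h2 := truncSum_add_nat p (saddle p N) N 2
  have h3 := truncSum_add_nat p (saddle p N) N 3
  simp only [Nat.cast_zero, add_zero, Nat.cast_one, Nat.cast_ofNat, pow_zero, mul_one, pow_one]
    at h0 h1 h2 h3
  set lam := tiltedParam p (saddle p N)
  have key : logCharFun p N s θ -
      (((s * (truncSum p (saddle p N) N - Real.Gamma p * saddle p N ^ (-p)) +
          θ * (truncSum (p + 1) (saddle p N) N - N) : ℝ) : ℂ) * Complex.I -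
        ((s ^ 2 * truncSum p (saddle p N) N + 2 * s * θ * truncSum (p + 1) (saddle p N) N +
          θ ^ 2 * truncSum (p + 2) (saddle p N) N : ℝ) : ℂ) / 2) =
      ∑ k ∈ Finset.Icc 1 N, (lam k : ℂ) *
        (Complex.exp ((s + k * θ : ℝ) * Complex.I) - 1 - (s + k * θ : ℝ) * Complex.I +
          ((s + k * θ : ℝ) : ℂ) ^ 2 / 2) := by
    have e1 : ∑ k ∈ Finset.Icc 1 N, (lam k : ℂ) * ((s + k * θ : ℝ) : ℂ) =
        ((s * truncSum p (saddle p N) N + θ * truncSum (p + 1) (saddle p N) N : ℝ) : ℂ) := by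
      rw [h0, h1, Finset.mul_sum, Finset.mul_sum, ← Finset.sum_add_distrib, Complex.ofReal_sum]
      refine Finset.sum_congr rfl fun k _ => ?_
      push_cast
      ring
    have e2 : ∑ k ∈ Finset.Icc 1 N, (lam k : ℂ) * ((s + k * θ : ℝ) : ℂ) ^ 2 =
        ((s ^ 2 * truncSum p (saddle p N) N + 2 * s * θ * truncSum (p + 1) (saddle p N) N +
          θ ^ 2 * truncSum (p + 2) (saddle p N) N : ℝ) : ℂ) := by
      rw [h0, h1, h2, Finset.mul_sum, Finset.mul_sum, Finset.mul_sum, ← Finset.sum_add_distrib,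
        ← Finset.sum_add_distrib, Complex.ofReal_sum]
      refine Finset.sum_congr rfl fun k _ => ?_
      push_cast
      ring
    have e3 : ∑ k ∈ Finset.Icc 1 N, (lam k : ℂ) *
        (Complex.exp ((s + k * θ : ℝ) * Complex.I) - 1 - (s + k * θ : ℝ) * Complex.I +
          ((s + k * θ : ℝ) : ℂ) ^ 2 / 2) =
        ∑ k ∈ Finset.Icc 1 N, (lam k : ℂ) * (Complex.exp ((s + k * θ : ℝ) * Complex.I) - 1) -
        (∑ k ∈ Finset.Icc 1 N, (lam k : ℂ) * ((s + k * θ : ℝ) : ℂ)) * Complex.I +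
        (∑ k ∈ Finset.Icc 1 N, (lam k : ℂ) * ((s + k * θ : ℝ) : ℂ) ^ 2) / 2 := by
      rw [Finset.sum_mul, Finset.sum_div, ← Finset.sum_sub_distrib, ← Finset.sum_add_distrib]
      exact Finset.sum_congr rfl fun k _ => by ring
    rw [e3, e1, e2, logCharFun]
    push_cast
    ring
  rw [key]
  refine (norm_sum_le _ _).trans ?_
  rw [h0, h3, Finset.mul_sum, Finset.mul_sum, ← Finset.sum_add_distrib, Finset.mul_sum]
  refine Finset.sum_le_sum fun k _ => ?_
  rw [norm_mul, Complex.norm_real, Real.norm_of_nonneg (tiltedParam_nonneg _ _ k)]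
  have hcube : |s + k * θ| ^ 3 ≤ 4 * (|s| ^ 3 + (k * |θ|) ^ 3) := by
    have ha : |s + k * θ| ≤ |s| + k * |θ| := by
      refine (abs_add_le _ _).trans ?_
      rw [abs_mul, Nat.abs_cast]
    refine (pow_le_pow_left₀ (abs_nonneg _) ha 3).trans ?_
    have := add_pow_le (abs_nonneg s) (show 0 ≤ k * |θ| by positivity) 3
    norm_num at this
    exact this
  calc _ ≤ lam k * (4 * (4 * (|s| ^ 3 + (k * |θ|) ^ 3))) := by
        refine mul_le_mul_of_nonneg_left ?_ (tiltedParam_nonneg _ _ k)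
        exact (norm_cexp_mul_I_sub_le _).trans (by linarith)
    _ = _ := by ring

/-- In the scaling `s = a δ ^ (p / 2)`, `θ = b δ ^ (p / 2 + 1)` the characteristic function becomes
Gaussian. -/
theorem tendsto_logCharFun {p : ℝ} (hp : 0 < p) (a b : ℝ) :
    Tendsto (fun N => logCharFun p N (a * saddle p N ^ (p / 2)) (b * saddle p N ^ (p / 2 + 1)))
      atTop (𝓝 ((-(a ^ 2 * Real.Gamma p + 2 * a * b * Real.Gamma (p + 1) +
        b ^ 2 * Real.Gamma (p + 2)) / 2 : ℝ) : ℂ)) := by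
  have hsplit : ∀ N, 0 < saddle p N → ∀ x y z : ℝ, x + y = z →
      saddle p N ^ x * saddle p N ^ y = saddle p N ^ z := fun N hN x y z h => by
    rw [← Real.rpow_add hN, h]
  -- The centring errors are bounded and multiplied by positive powers of `saddle p N`.
  have hA : Tendsto (fun N => a * saddle p N ^ (p / 2) *
        (truncSum p (saddle p N) N - Real.Gamma p * saddle p N ^ (-p)) +
      b * saddle p N ^ (p / 2 + 1) * (truncSum (p + 1) (saddle p N) N - N)) atTop (𝓝 0) := by
    have h1 := (tendsto_mul_truncSum_sub hp hp (half_pos hp)).const_mul a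
    have h2 := (tendsto_mul_truncSum_sub hp (show 0 < p + 1 by linarith)
      (show 0 < p / 2 + 1 by linarith)).const_mul b
    have h := h1.add h2
    rw [mul_zero, mul_zero, add_zero] at h
    refine h.congr fun N => ?_
    rw [Gamma_mul_saddle_rpow hp]
    ring
  have hB : Tendsto (fun N => (a * saddle p N ^ (p / 2)) ^ 2 * truncSum p (saddle p N) N +
      2 * (a * saddle p N ^ (p / 2)) * (b * saddle p N ^ (p / 2 + 1)) *
        truncSum (p + 1) (saddle p N) N +
      (b * saddle p N ^ (p / 2 + 1)) ^ 2 * truncSum (p + 2) (saddle p N) N) atTop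
      (𝓝 (a ^ 2 * Real.Gamma p + 2 * a * b * Real.Gamma (p + 1) + b ^ 2 * Real.Gamma (p + 2))) := by
    have h := (((tendsto_mul_truncSum hp hp).const_mul (a ^ 2)).add
      ((tendsto_mul_truncSum hp (show 0 < p + 1 by linarith)).const_mul (2 * a * b))).add
      ((tendsto_mul_truncSum hp (show 0 < p + 2 by linarith)).const_mul (b ^ 2))
    refine h.congr' ?_
    filter_upwards [eventually_saddle_pos hp] with N hN
    rw [← hsplit N hN (p / 2) (p / 2) p (by ring),
      ← hsplit N hN (p / 2) (p / 2 + 1) (p + 1) (by ring),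
      ← hsplit N hN (p / 2 + 1) (p / 2 + 1) (p + 2) (by ring)]
    ring
  -- Both cubic terms are `O(δ ^ (p / 2))`.
  have hR : Tendsto (fun N => 16 * (|a * saddle p N ^ (p / 2)| ^ 3 * truncSum p (saddle p N) N +
      |b * saddle p N ^ (p / 2 + 1)| ^ 3 * truncSum (p + 3) (saddle p N) N)) atTop (𝓝 0) := by
    have h := ((tendsto_rpow_saddle hp (half_pos hp)).mul
      (((tendsto_mul_truncSum hp hp).const_mul (|a| ^ 3)).add
      ((tendsto_mul_truncSum hp (show 0 < p + 3 by linarith)).const_mul (|b| ^ 3)))).const_mul 16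
    rw [zero_mul, mul_zero] at h
    refine h.congr' ?_
    filter_upwards [eventually_saddle_pos hp] with N hN
    rw [abs_mul, abs_mul, abs_of_nonneg (Real.rpow_nonneg hN.le _),
      abs_of_nonneg (Real.rpow_nonneg hN.le _), mul_pow, mul_pow]
    have e1 : (saddle p N ^ (p / 2)) ^ 3 = saddle p N ^ (p / 2) * saddle p N ^ p := by
      rw [← hsplit N hN (p / 2) (p / 2) p (by ring)]
      ring
    have e2 : (saddle p N ^ (p / 2 + 1)) ^ 3 = saddle p N ^ (p / 2) * saddle p N ^ (p + 3) := by
      rw [← Real.rpow_natCast, ← Real.rpow_mul hN.le, ← Real.rpow_add hN]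
      congr 1
      push_cast
      ring
    rw [e1, e2]
    ring
  have hmain := (((Complex.continuous_ofReal.tendsto _).comp hA).mul_const Complex.I).sub
    (((Complex.continuous_ofReal.tendsto _).comp hB).div_const 2)
  have hdiff := squeeze_zero_norm (fun N => norm_logCharFun_sub_le p N
    (a * saddle p N ^ (p / 2)) (b * saddle p N ^ (p / 2 + 1))) hR
  have h := hdiff.add hmain
  convert h using 2
  · simp [Function.comp]
  · push_cast
    simp
    ring

/-! ### The characteristic function of the number of groups -/

theorem integrable_exp_neg_mul_abs_rpow {r c : ℝ} (hr : 0 < r) (hc : 0 < c) :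
    Integrable fun b : ℝ => Real.exp (-c * |b| ^ r) := by
  refine .of_integral_ne_zero ?_
  rw [integral_comp_abs (f := fun b => Real.exp (-c * b ^ r)), integral_exp_neg_mul_rpow hr hc]
  have : 0 < Real.Gamma (1 / r + 1) := Real.Gamma_pos_of_pos (by positivity)
  positivity

theorem norm_exp_logCharFun (p : ℝ) (N : ℕ) (s θ : ℝ) :
    ‖Complex.exp (logCharFun p N s θ)‖ = Real.exp (-∑ k ∈ Finset.Icc 1 N,
      tiltedParam p (saddle p N) k * (1 - Real.cos (s + k * θ))) := by
  rw [Complex.norm_exp, logCharFun, Complex.sub_re, Complex.re_sum, ← Finset.sum_neg_distrib]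
  congr 1
  rw [Complex.re_ofReal_mul, Complex.I_re, mul_zero, sub_zero]
  refine Finset.sum_congr rfl fun k _ => ?_
  rw [Complex.re_ofReal_mul, Complex.sub_re, Complex.exp_ofReal_mul_I_re, Complex.one_re]
  ring

/-- An integrable majorant of the rescaled characteristic function, uniform in `N`: Gaussian for
`|θ|` up to order `δ`, stretched exponential beyond, where `|b| δ ^ (p / 2 + 1) ≤ π` bounds
`δ ^ (-p)` below by a power of `|b|`. -/
theorem exists_norm_exp_logCharFun_le {p : ℝ} (hp : 0 < p) : ∃ c : ℝ, 0 < c ∧ ∃ c' : ℝ, 0 < c' ∧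
    ∀ᶠ N in atTop, ∀ s b : ℝ, |b * saddle p N ^ (p / 2 + 1)| ≤ Real.pi →
      ‖Complex.exp (logCharFun p N s (b * saddle p N ^ (p / 2 + 1)))‖ ≤
        Real.exp (-c * b ^ 2) + Real.exp (-c' * |b| ^ (p / (p / 2 + 1))) := by
  obtain ⟨c, hc, H⟩ := exists_le_sum_one_sub_cos p
  have hr : 0 < p / (p / 2 + 1) := by positivity
  refine ⟨c, hc, c * (1 / Real.pi) ^ (p / (p / 2 + 1)), by positivity, ?_⟩
  have hΓ := Real.Gamma_pos_of_pos (show 0 < p + 1 by linarith)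
  filter_upwards [eventually_ge_atTop 1, (tendsto_saddle hp).eventually (eventually_le_nhds
    zero_lt_one), ((tendsto_rpow_neg_saddle hp hp).const_mul_atTop hΓ).eventually_ge_atTop 6]
    with N hN hδ1 hδN s b hb
  have hδ := saddle_pos hp hN
  rw [← saddle_mul_self hp hN] at hδN
  rw [norm_exp_logCharFun]
  have h1 := H _ hδ hδ1 N hδN s _ hb
  have h2 : (b * saddle p N ^ (p / 2 + 1) / saddle p N) ^ 2 = b ^ 2 * saddle p N ^ p := by
    rw [mul_div_assoc, ← Real.rpow_sub_one hδ.ne', mul_pow, ← Real.rpow_natCast (saddle p N ^ _) 2,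
      ← Real.rpow_mul hδ.le]
    congr 2
    push_cast
    ring
  have h3 : saddle p N ^ (-p) * saddle p N ^ p = 1 := by
    rw [← Real.rpow_add hδ, neg_add_cancel, Real.rpow_zero]
  rw [h2] at h1
  rcases le_total 1 (b ^ 2 * saddle p N ^ p) with h | h
  · rw [min_eq_left h, mul_one] at h1
    refine (Real.exp_le_exp.2 ?_).trans (le_add_of_nonneg_left (Real.exp_nonneg _))
    rw [neg_mul, neg_le_neg_iff]
    refine le_trans ?_ h1
    rw [mul_assoc]
    gcongr
    rw [← Real.mul_rpow (by positivity) (abs_nonneg b)]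
    have h4 : 1 / Real.pi * |b| ≤ saddle p N ^ (-(p / 2 + 1)) := by
      rw [abs_mul, abs_of_pos (Real.rpow_pos_of_pos hδ _)] at hb
      rw [Real.rpow_neg hδ.le, one_div_mul_eq_div, div_le_iff₀ Real.pi_pos,
        inv_mul_eq_div, le_div_iff₀ (by positivity)]
      exact hb
    refine (Real.rpow_le_rpow (by positivity) h4 hr.le).trans_eq ?_
    rw [← Real.rpow_mul hδ.le]
    congr 1
    field_simp
  · rw [min_eq_right h] at h1
    refine (Real.exp_le_exp.2 ?_).trans (le_add_of_nonneg_right (Real.exp_nonneg _))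
    rw [neg_mul, neg_le_neg_iff]
    refine le_trans (le_of_eq ?_) h1
    linear_combination (-c * b ^ 2) * h3

theorem continuous_logCharFun (p : ℝ) (N : ℕ) (s : ℝ) : Continuous (logCharFun p N s) := by
  unfold logCharFun
  fun_prop

theorem integral_exp_quadratic {A B C : ℝ} (hC : 0 < C) :
    ∫ b : ℝ, Complex.exp ((-(A + 2 * B * b + b ^ 2 * C) / 2 : ℝ) : ℂ) =
      ((Real.exp (-(A - B ^ 2 / C) / 2) * Real.sqrt (Real.pi / (C / 2)) : ℝ) : ℂ) := by
  have h : ∀ b : ℝ, Complex.exp ((-(A + 2 * B * b + b ^ 2 * C) / 2 : ℝ) : ℂ) =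
      ((Real.exp (-(A - B ^ 2 / C) / 2) * Real.exp (-(C / 2) * (b + B / C) ^ 2) : ℝ) : ℂ) := by
    intro b
    rw [← Real.exp_add, ← Complex.ofReal_exp]
    congr 2
    field_simp
    ring
  simp_rw [h]
  rw [integral_complex_ofReal, integral_const_mul,
    integral_add_right_eq_self (fun b : ℝ => Real.exp (-(C / 2) * b ^ 2)), integral_gaussian]

/-- The Fourier integral of the characteristic function, in the scaling
`θ = b δ ^ (p / 2 + 1)`. -/
theorem tendsto_integral_exp_logCharFun {p : ℝ} (hp : 0 < p) (a : ℝ) :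
    Tendsto (fun N => ((saddle p N ^ (p / 2 + 1))⁻¹ : ℝ) * ∫ θ in (-Real.pi)..Real.pi,
        Complex.exp (logCharFun p N (a * saddle p N ^ (p / 2)) θ)) atTop
      (𝓝 ((Real.exp (-(a ^ 2 * (Real.Gamma p / (p + 1))) / 2) *
        Real.sqrt (Real.pi / (Real.Gamma (p + 2) / 2)) : ℝ) : ℂ)) := by
  have hΓ := Real.Gamma_pos_of_pos (show 0 < p + 2 by linarith)
  have hΓp := Real.Gamma_pos_of_pos hp
  have hvar : a ^ 2 * Real.Gamma p - (a * Real.Gamma (p + 1)) ^ 2 / Real.Gamma (p + 2) =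
      a ^ 2 * (Real.Gamma p / (p + 1)) := by
    have h1 : Real.Gamma (p + 1) = p * Real.Gamma p := Real.Gamma_add_one hp.ne'
    have h2 : Real.Gamma (p + 2) = (p + 1) * (p * Real.Gamma p) := by
      rw [show p + 2 = (p + 1) + 1 by ring, Real.Gamma_add_one (by linarith), h1]
    rw [h1, h2]
    field_simp
    ring
  rw [← hvar, ← integral_exp_quadratic hΓ]
  obtain ⟨c, hc, c', hc', hbound⟩ := exists_norm_exp_logCharFun_le hp
  have hr : 0 < p / (p / 2 + 1) := by positivity
  have hscale := tendsto_rpow_saddle hp (show 0 < p / 2 + 1 by linarith)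
  have key : Tendsto (fun N => ∫ b : ℝ,
    {b : ℝ | |b * saddle p N ^ (p / 2 + 1)| ≤ Real.pi}.indicator
      (fun b => Complex.exp (logCharFun p N (a * saddle p N ^ (p / 2))
        (b * saddle p N ^ (p / 2 + 1)))) b) atTop
      (𝓝 (∫ b : ℝ, Complex.exp ((-(a ^ 2 * Real.Gamma p + 2 * (a * Real.Gamma (p + 1)) * b +
        b ^ 2 * Real.Gamma (p + 2)) / 2 : ℝ) : ℂ))) := by
    refine tendsto_integral_filter_of_dominated_convergence
      (fun b => Real.exp (-c * b ^ 2) + Real.exp (-c' * |b| ^ (p / (p / 2 + 1)))) ?_ ?_ ?_ ?_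
    · refine Eventually.of_forall fun N => AEStronglyMeasurable.indicator ?_ ?_
      · exact (Complex.continuous_exp.comp ((continuous_logCharFun p N _).comp
          (continuous_id.mul continuous_const))).aestronglyMeasurable
      · exact (isClosed_le (by fun_prop) continuous_const).measurableSet
    · filter_upwards [hbound] with N hN
      refine Eventually.of_forall fun b => ?_
      by_cases hb : |b * saddle p N ^ (p / 2 + 1)| ≤ Real.pi
      · rw [Set.indicator_of_mem
          (show b ∈ {b : ℝ | |b * saddle p N ^ (p / 2 + 1)| ≤ Real.pi} from hb)]
        exact hN _ b hb
      · rw [Set.indicator_of_notMem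
          (show b ∉ {b : ℝ | |b * saddle p N ^ (p / 2 + 1)| ≤ Real.pi} from hb),
          norm_zero]
        positivity
    · exact (integrable_exp_neg_mul_sq hc).add (integrable_exp_neg_mul_abs_rpow hr hc')
    · refine Eventually.of_forall fun b => ?_
      have hb : Tendsto (fun N => |b * saddle p N ^ (p / 2 + 1)|) atTop (𝓝 0) := by
        simpa using (hscale.const_mul b).abs
      have h := (Complex.continuous_exp.tendsto _).comp (tendsto_logCharFun hp a b)
      rw [show a ^ 2 * Real.Gamma p + 2 * (a * Real.Gamma (p + 1)) * b +
        b ^ 2 * Real.Gamma (p + 2) =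
        a ^ 2 * Real.Gamma p + 2 * a * b * Real.Gamma (p + 1) + b ^ 2 * Real.Gamma (p + 2) by ring]
      refine h.congr' ?_
      filter_upwards [hb.eventually (eventually_le_nhds Real.pi_pos)] with N hN
      exact (Set.indicator_of_mem (s := {b : ℝ | |b * saddle p N ^ (p / 2 + 1)| ≤ Real.pi}) hN
        fun b => Complex.exp (logCharFun p N (a * saddle p N ^ (p / 2))
          (b * saddle p N ^ (p / 2 + 1)))).symm
  refine key.congr' ?_
  filter_upwards [eventually_saddle_pos hp] with N hN
  have hpos : 0 < saddle p N ^ (p / 2 + 1) := by positivity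
  have hset : {b : ℝ | |b * saddle p N ^ (p / 2 + 1)| ≤ Real.pi} =
      Set.Icc (-Real.pi / saddle p N ^ (p / 2 + 1)) (Real.pi / saddle p N ^ (p / 2 + 1)) := by
    ext b
    rw [Set.mem_ofPred_eq, Set.mem_Icc, div_le_iff₀ hpos, le_div_iff₀ hpos, abs_le]
  rw [hset, integral_indicator measurableSet_Icc, integral_Icc_eq_integral_Ioc,
    ← intervalIntegral.integral_of_le
      (div_le_div_of_nonneg_right (by linarith [Real.pi_pos]) hpos.le),
    intervalIntegral.integral_comp_mul_right (fun θ => Complex.exp (logCharFun p N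
      (a * saddle p N ^ (p / 2)) θ)) hpos.ne', div_mul_cancel₀ _ hpos.ne',
    div_mul_cancel₀ _ hpos.ne', Complex.real_smul]

theorem sum_mul_groupCount {N : ℕ} (η : Nat.Partition N) :
    ∑ j ∈ Finset.Icc 1 N, j * CoagFrag.groupCount η j = N := by
  have h : η.parts.sum = ∑ j ∈ η.parts.toFinset, η.parts.count j * j := by
    rw [Finset.sum_multiset_count]
    simp
  conv_rhs => rw [← η.parts_sum, h]
  simp only [CoagFrag.groupCount, mul_comm]
  refine (Finset.sum_subset (fun j hj => ?_) fun j _ hj => ?_).symm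
  · rw [Multiset.mem_toFinset] at hj
    exact Finset.mem_Icc.2 ⟨η.parts_pos hj, η.le_of_mem_parts hj⟩
  · rw [Multiset.mem_toFinset] at hj
    rw [Multiset.count_eq_zero_of_notMem hj, mul_zero]

/-- Tilting by `exp (- δ k)` only changes the weight of a partition of `N` by the constant factor
`exp (- δ N)`. -/
theorem prod_tilted_eq (p δ s : ℝ) {N : ℕ} (η : Nat.Partition N) :
    ∏ j ∈ Finset.Icc 1 N, ((tiltedParam p δ j : ℂ) * Complex.exp (s * Complex.I)) ^
        CoagFrag.groupCount η j / ((CoagFrag.groupCount η j).factorial : ℂ) =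
      Complex.exp (-(δ * N)) * ((CoagFrag.weight (CoagFrag.powerParam p) η : ℂ) *
        Complex.exp (s * CoagFrag.numGroups η * Complex.I)) := by
  have h1 : Complex.exp (-(δ * N)) =
      ∏ j ∈ Finset.Icc 1 N, Complex.exp (-(δ * j)) ^ CoagFrag.groupCount η j := by
    conv_lhs => rw [← sum_mul_groupCount η]
    simp_rw [← Complex.exp_nat_mul]
    rw [← Complex.exp_sum, Nat.cast_sum, Finset.mul_sum, ← Finset.sum_neg_distrib]
    congr 1
    refine Finset.sum_congr rfl fun j _ => ?_
    push_cast
    ring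
  have h2 : Complex.exp (s * CoagFrag.numGroups η * Complex.I) =
      ∏ j ∈ Finset.Icc 1 N, Complex.exp (s * Complex.I) ^ CoagFrag.groupCount η j := by
    simp_rw [← Complex.exp_nat_mul]
    rw [← Complex.exp_sum, CoagFrag.numGroups, Nat.cast_sum, Finset.mul_sum, Finset.sum_mul]
    congr 1
    refine Finset.sum_congr rfl fun j _ => ?_
    ring
  rw [h1, h2, CoagFrag.weight, Complex.ofReal_prod, ← Finset.prod_mul_distrib,
    ← Finset.prod_mul_distrib]
  refine Finset.prod_congr rfl fun j _ => ?_
  rw [tiltedParam, CoagFrag.powerParam]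
  push_cast
  rw [mul_pow, mul_pow]
  ring

/-- Cauchy's formula for the characteristic function of `ν_N`, up to a factor that does not depend
on `s`. -/
theorem exists_integral_exp_logCharFun_eq (p : ℝ) (N : ℕ) : ∃ K : ℂ, K ≠ 0 ∧ ∀ s : ℝ,
    ∫ θ in (-Real.pi)..Real.pi, Complex.exp (logCharFun p N s θ) =
      K * ∑ η : Nat.Partition N, (CoagFrag.weight (CoagFrag.powerParam p) η : ℂ) *
        Complex.exp ((s * (CoagFrag.numGroups η - Real.Gamma p * saddle p N ^ (-p)) : ℝ) *
          Complex.I) := by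
  set lam := tiltedParam p (saddle p N) with hlam
  set m : ℝ := Real.Gamma p * saddle p N ^ (-p) with hm
  refine ⟨Complex.exp (-∑ k ∈ Finset.Icc 1 N, (lam k : ℂ)) * (2 * Real.pi) *
    Complex.exp (-(saddle p N * N)), ?_, fun s => ?_⟩
  · exact mul_ne_zero (mul_ne_zero (Complex.exp_ne_zero _) (by simp [Real.pi_ne_zero]))
      (Complex.exp_ne_zero _)
  · have h := integral_exp_sum_eq_sum_partition
      (fun k => (lam k : ℂ) * Complex.exp (s * Complex.I)) N
    have hint : ∀ θ : ℝ, Complex.exp (logCharFun p N s θ) =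
        (Complex.exp (-∑ k ∈ Finset.Icc 1 N, (lam k : ℂ)) * Complex.exp (-(s * m * Complex.I))) *
        (Complex.exp (∑ k ∈ Finset.Icc 1 N, (lam k : ℂ) * Complex.exp (s * Complex.I) *
          Complex.exp (k * θ * Complex.I)) * Complex.exp (-(N * θ * Complex.I))) := by
      intro θ
      rw [← Complex.exp_add, ← Complex.exp_add, ← Complex.exp_add, logCharFun]
      congr 1
      have : ∑ k ∈ Finset.Icc 1 N, (lam k : ℂ) *
          (Complex.exp ((s + k * θ : ℝ) * Complex.I) - 1) =
          ∑ k ∈ Finset.Icc 1 N, (lam k : ℂ) * Complex.exp (s * Complex.I) *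
          Complex.exp (k * θ * Complex.I) - ∑ k ∈ Finset.Icc 1 N, (lam k : ℂ) := by
        rw [← Finset.sum_sub_distrib]
        refine Finset.sum_congr rfl fun k _ => ?_
        rw [mul_assoc, ← Complex.exp_add]
        push_cast
        ring_nf
      rw [this, ← hm]
      push_cast
      ring
    simp_rw [hint]
    rw [intervalIntegral.integral_const_mul, h]
    simp_rw [hlam, prod_tilted_eq]
    rw [← Finset.mul_sum]
    have h2 : ∑ η : Nat.Partition N, (CoagFrag.weight (CoagFrag.powerParam p) η : ℂ) *
        Complex.exp ((s * (CoagFrag.numGroups η - m) : ℝ) * Complex.I) =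
        Complex.exp (-(s * m * Complex.I)) * ∑ η : Nat.Partition N,
          (CoagFrag.weight (CoagFrag.powerParam p) η : ℂ) *
            Complex.exp (s * CoagFrag.numGroups η * Complex.I) := by
      rw [Finset.mul_sum]
      refine Finset.sum_congr rfl fun η _ => ?_
      rw [mul_left_comm, ← Complex.exp_add]
      congr 2
      push_cast
      ring
    rw [h2]
    ring

theorem integral_equilibriumMeasure (p : ℝ) (N : ℕ) (g : Nat.Partition N → ℂ) :
    ∫ η, g η ∂(CoagFrag.equilibriumMeasure (CoagFrag.powerParam p) N) =
      (∑ η : Nat.Partition N, (CoagFrag.weight (CoagFrag.powerParam p) η : ℂ) * g η) /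
        ∑ η : Nat.Partition N, (CoagFrag.weight (CoagFrag.powerParam p) η : ℂ) := by
  have hw : ∀ η : Nat.Partition N, 0 ≤ CoagFrag.weight (CoagFrag.powerParam p) η := fun η =>
    (CoagFrag.weight_pos (CoagFrag.powerParam_pos p) η).le
  have hc : 0 < CoagFrag.partitionFunction (CoagFrag.powerParam p) N :=
    CoagFrag.partitionFunction_pos (CoagFrag.powerParam_pos p) N
  rw [CoagFrag.equilibriumMeasure, integral_finsetSum_measure, Finset.sum_div]
  · refine Finset.sum_congr rfl fun η _ => ?_
    rw [integral_smul_measure, integral_dirac, ENNReal.toReal_ofReal (div_nonneg (hw η) hc.le),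
      Complex.real_smul, CoagFrag.partitionFunction]
    push_cast
    ring
  · intro η _
    exact (integrable_dirac (by simp)).smul_measure ENNReal.ofReal_ne_top

/-- `s` is `t` divided by the normalisation of `ν_N`; the denominator is the case `s = 0`,
written so as to match `tendsto_integral_exp_logCharFun`. -/
theorem charFun_map_eq {p : ℝ} (hp : 0 < p) {N : ℕ} (hN : 1 ≤ N) (t : ℝ) :
    charFun ((CoagFrag.equilibriumMeasure (CoagFrag.powerParam p) N).map
      fun η : Nat.Partition N =>
        ((CoagFrag.numGroups η : ℝ) - CoagFrag.Q p * (N : ℝ) ^ (p / (p + 1))) /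
          (Real.sqrt (CoagFrag.d p) * (N : ℝ) ^ (p / (2 * p + 2)))) t =
      (∫ θ in (-Real.pi)..Real.pi, Complex.exp (logCharFun p N
        (t / Real.sqrt (Real.Gamma p / (p + 1)) * saddle p N ^ (p / 2)) θ)) /
      ∫ θ in (-Real.pi)..Real.pi, Complex.exp (logCharFun p N (0 * saddle p N ^ (p / 2)) θ) := by
  obtain ⟨K, hK, hKs⟩ := exists_integral_exp_logCharFun_eq p N
  have hδ := saddle_pos hp hN
  rw [hKs, hKs, mul_div_mul_left _ _ hK, charFun_apply_real,
    integral_map (measurable_from_top).aemeasurable (by fun_prop), integral_equilibriumMeasure]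
  congr 1
  · refine Finset.sum_congr rfl fun η _ => ?_
    rw [Q_mul_rpow hp, sqrt_d_mul_rpow hp hN, Real.rpow_neg hδ.le (p / 2), ← Complex.ofReal_mul]
    congr 4
    field_simp
  · simp

/-- The factors `δ ^ (-(p / 2 + 1))` and the Gaussian integrals cancel in the quotient. -/
theorem tendsto_charFun_map {p : ℝ} (hp : 0 < p) (t : ℝ) :
    Tendsto (fun N : ℕ => charFun ((CoagFrag.equilibriumMeasure (CoagFrag.powerParam p) N).map
      fun η : Nat.Partition N =>
        ((CoagFrag.numGroups η : ℝ) - CoagFrag.Q p * (N : ℝ) ^ (p / (p + 1))) /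
          (Real.sqrt (CoagFrag.d p) * (N : ℝ) ^ (p / (2 * p + 2)))) t) atTop
      (𝓝 (Complex.exp (-(t ^ 2 / 2)))) := by
  have hΓp := Real.Gamma_pos_of_pos hp
  have hv : 0 < Real.Gamma p / (p + 1) := by positivity
  have hΓ := Real.Gamma_pos_of_pos (show 0 < p + 2 by linarith)
  have h0 := tendsto_integral_exp_logCharFun hp 0
  have h1 := tendsto_integral_exp_logCharFun hp (t / Real.sqrt (Real.Gamma p / (p + 1)))
  have hne : ((Real.exp (-(0 ^ 2 * (Real.Gamma p / (p + 1))) / 2) *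
      Real.sqrt (Real.pi / (Real.Gamma (p + 2) / 2)) : ℝ) : ℂ) ≠ 0 := by
    have := Real.pi_pos
    rw [Complex.ofReal_ne_zero]
    positivity
  have h := h1.div h0 hne
  have hlim : ((Real.exp (-((t / Real.sqrt (Real.Gamma p / (p + 1))) ^ 2 *
      (Real.Gamma p / (p + 1))) / 2) * Real.sqrt (Real.pi / (Real.Gamma (p + 2) / 2)) : ℝ) : ℂ) /
      ((Real.exp (-(0 ^ 2 * (Real.Gamma p / (p + 1))) / 2) *
      Real.sqrt (Real.pi / (Real.Gamma (p + 2) / 2)) : ℝ) : ℂ) = Complex.exp (-(t ^ 2 / 2)) := by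
    have hs : Real.sqrt (Real.pi / (Real.Gamma (p + 2) / 2)) ≠ 0 := by
      have := Real.pi_pos
      positivity
    rw [← Complex.ofReal_div, mul_div_mul_right _ _ hs, div_pow, Real.sq_sqrt hv.le,
      div_mul_cancel₀ _ hv.ne', zero_pow two_ne_zero, zero_mul, neg_zero, zero_div, Real.exp_zero,
      div_one]
    push_cast
    congr 1
    ring
  rw [hlim] at h
  refine h.congr' ?_
  filter_upwards [eventually_ge_atTop 1] with N hN
  have hδ := saddle_pos hp hN
  rw [charFun_map_eq hp hN, Pi.div_apply, mul_div_mul_left]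
  have : 0 < saddle p N ^ (p / 2 + 1) := by positivity
  exact Complex.ofReal_ne_zero.2 (inv_ne_zero this.ne')

theorem theorem4p6 (p : ℝ) (hp : 0 < p) :
    TendstoInDistribution
      (fun (N : ℕ) (η : Nat.Partition N) =>
        ((CoagFrag.numGroups η : ℝ) - CoagFrag.Q p * (N : ℝ) ^ (p / (p + 1))) /
          (Real.sqrt (CoagFrag.d p) * (N : ℝ) ^ (p / (2 * p + 2))))
      atTop (id : ℝ → ℝ)
      (fun N : ℕ => CoagFrag.equilibriumMeasure (CoagFrag.powerParam p) N)
      (gaussianReal 0 1) where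
  forall_aemeasurable N := measurable_from_top.aemeasurable
  aemeasurable_limit := aemeasurable_id
  tendsto := by
    refine ProbabilityMeasure.tendsto_iff_tendsto_charFun.2 fun t => ?_
    simpa [charFun_gaussianReal, Measure.map_id, neg_div] using tendsto_charFun_map hp t
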